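/- Let $G$ be a finite simple graph with $n$ vertices. For $X\subseteq V(G)$ let $N(X)$ be the set of vertices outside $X$ that have a neighbour in $X$. For a real number $C>0$, $G$ is a $C$-expander if $n\ge 3$, $|N(X)|\ge C|X|$ for every $X\subseteq V(G)$ with $|X|<\frac{n}{2C}$, and there is an edge of $G$ between any two disjoint sets $X,Y\subseteq V(G)$ with $|X|,|Y|\ge \frac{n}{2C}$. A linear forest is a graph that is a vertex-disjoint union of paths; $\mathrm{End}(\mathcal F)$ denotes the set of endpoints of the paths of a linear forest $\mathcal F$, and the length of a path is its number of edges. A linear forest in $G$ is spanning if it contains all vertices of $G$. There is an absolute constant $K$ such that the following holds. Let $C>10^{10}$, let $G$ be an $n$-vertex $C$-expander, and let $\mathcal F$ be a spanning linear forest in $G$ with no isolated vertices such that at least $0.1n$ vertices of $G$ belong to paths of $\mathcal F$ of length at least $100$ and at most $\sqrt n$. Let $x,y\in\mathrm{End}(\mathcal F)$ be distinct. Then there is a spanning linear forest $\mathcal F'$ in $G$ with no isolated vertices such that $$\mathrm{End}(\mathcal F')=\mathrm{End}(\mathcal F)\setminus\{x,y\}\qquad\text{and}\qquad |E(\mathcal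 F)\,\triangle\,E(\mathcal F')|\le K\log n .$$ -/

import Mathlib

/-- The outer neighbourhood `N_G(X)`: vertices outside `X` with a neighbour in `X`. -/
def outerNbhd {V : Type*} (G : SimpleGraph V) (X : Set V) : Set V :=
  {v | v ∉ X ∧ ∃ u ∈ X, G.Adj u v}

/-- A finite graph on `n ≥ 3` vertices is a `C`-expander if `|N(X)| ≥ C|X|` whenever
`|X| < n/(2C)`, and there is an edge between any two disjoint vertex sets of size at least
`n/(2C)`. -/
structure IsExpander {V : Type*} [Fintype V] (C : ℝ) (G : SimpleGraph V) : Prop where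
  three_le : 3 ≤ Fintype.card V
  expands : ∀ X : Set V, (X.ncard : ℝ) < (Fintype.card V : ℝ) / (2 * C) →
    C * (X.ncard : ℝ) ≤ ((outerNbhd G X).ncard : ℝ)
  joined : ∀ X Y : Set V, Disjoint X Y →
    (Fintype.card V : ℝ) / (2 * C) ≤ (X.ncard : ℝ) →
    (Fintype.card V : ℝ) / (2 * C) ≤ (Y.ncard : ℝ) →
    ∃ x ∈ X, ∃ y ∈ Y, G.Adj x y

/-- A linear forest with vertex set `V`: a forest of maximum degree at most 2, that is, a finite
graph each of whose connected components is a path (possibly with a single vertex). -/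
def IsLinearForest {V : Type*} [Fintype V] (F : SimpleGraph V) : Prop :=
  F.IsAcyclic ∧ ∀ v : V, (F.neighborSet v).ncard ≤ 2

/-- `F` is a linear forest in `G` that contains every vertex of `G`. -/
def IsSpanningLinearForest {V : Type*} [Fintype V] (G F : SimpleGraph V) : Prop :=
  F ≤ G ∧ IsLinearForest F

/-- No vertex of `F` is isolated, i.e. no path of the linear forest is a single vertex. -/
def NoIsolatedVertices {V : Type*} (F : SimpleGraph V) : Prop :=
  ∀ v : V, ¬ F.IsIsolated v

/-- The set `End(F)` of endpoints of the paths of a linear forest: in a path, the endpoints are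
the vertices with at most one neighbour. -/
def endpoints {V : Type*} (F : SimpleGraph V) : Set V :=
  {v | (F.neighborSet v).ncard ≤ 1}

/-- The length (number of edges) of the path of the linear forest `F` that contains `v`. -/
noncomputable def pathLength {V : Type*} (F : SimpleGraph V) (v : V) : ℕ :=
  (F.connectedComponentMk v).toSimpleGraph.edgeSet.ncard

/-! The tool is Pósa rotation on a forest. If `s` is the marked end and `sv` an edge of `G`, a
suitable forest edge `vw` is exchanged for `sv`, and `w` becomes the marked end; `v` may lie on
another path. Only acyclicity and degrees are tracked: an acyclic subgraph of `G` in which exactly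
`x` and `y` gain one degree is the desired forest (`linearForest_of_deg_eq`).

Expansion multiplies the set of reachable ends by a constant per round (`le_ncard_rotationEnds`), so
`O(log n)` rotations reach `n/(2C)` ends. Rotations can be confined to a set `W` of linear size:
sets avoiding a small exceptional set `Y` expand into `W` (`exists_exceptional_set`), and rotating
only at vertices outside the neighbourhood of `Y` keeps the new ends outside `Y`.

For large `n`, take disjoint unions `A`, `B` of medium paths. Rotations that leave `A` and `B`
intact replace `x`, `y` by ends outside `A ∪ B` that expand into `A` and `B` respectively. The first
is attached to some `v ∈ A`, an edge at `v` is broken, and the loose end is rotated inside `A`,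
giving `n/(2C)` candidates never connected to `v` (`exists_rearrangement`); the same happens in `B`.
An edge of `G` between the two candidate sets completes the join (`exists_join`). If `n ≤ 2C`, then
`G` is complete and a path is cut open and inserted between `x` and `y`. -/

open SimpleGraph in
theorem SimpleGraph.IsAcyclic.not_reachable_deleteEdges {V : Type*} {H : SimpleGraph V}
    (hH : H.IsAcyclic) {v w : V} (h : H.Adj v w) :
    ¬ (H.deleteEdges {s(v, w)}).Reachable v w :=
  isBridge_iff.1 (isAcyclic_iff_forall_adj_isBridge.1 hH h)

theorem SimpleGraph.not_reachable_of_closed {V : Type*} {H : SimpleGraph V} {T : Set V}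
    (hT : ∀ a b, H.Adj a b → a ∈ T → b ∈ T) {s t : V} (hs : s ∈ T) (ht : t ∉ T) :
    ¬ H.Reachable s t := by
  rintro ⟨p⟩
  induction p with
  | nil => exact ht hs
  | cons h _ ih => exact ih (hT _ _ h hs) ht

/-- A graph without edges between `T` and its complement is acyclic if both parts are. -/
theorem SimpleGraph.isAcyclic_of_closed {V : Type*} {H H₁ H₂ : SimpleGraph V} {T : Set V}
    (h₁ : H₁.IsAcyclic) (h₂ : H₂.IsAcyclic)
    (hT : ∀ a b, H.Adj a b → a ∈ T → b ∈ T ∧ H₁.Adj a b)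
    (hT' : ∀ a b, H.Adj a b → a ∉ T → H₂.Adj a b) : H.IsAcyclic := by
  have hin : ∀ {a b : V} (p : H.Walk a b), a ∈ T → ∀ e ∈ p.edges, e ∈ H₁.edgeSet := by
    intro a b p
    induction p with
    | nil => simp
    | cons h q ih =>
      intro ha e he
      rcases List.mem_cons.1 he with rfl | he
      · exact (hT _ _ h ha).2
      · exact ih (hT _ _ h ha).1 e he
  have hout : ∀ {a b : V} (p : H.Walk a b), a ∉ T → ∀ e ∈ p.edges, e ∈ H₂.edgeSet := by
    intro a b p
    induction p with
    | nil => simp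
    | cons h q ih =>
      intro ha e he
      rcases List.mem_cons.1 he with rfl | he
      · exact hT' _ _ h ha
      · exact ih (fun hb => ha (hT _ _ h.symm hb).1) e he
  intro v c hc
  by_cases hv : v ∈ T
  · exact h₁ _ (hc.transfer (hin c hv))
  · exact h₂ _ (hc.transfer (hout c hv))

/-! ### A single rotation: acyclicity and degrees -/

/-- Remove the edge `vw` and add the edge `sv`. -/
def rotate {V : Type*} (H : SimpleGraph V) (s v w : V) : SimpleGraph V :=
  H.deleteEdges {s(v, w)} ⊔ SimpleGraph.edge s v

theorem rotate_adj {V : Type*} {H : SimpleGraph V} {s v w a b : V} (hsv : s ≠ v) :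
    (rotate H s v w).Adj a b ↔
      (H.Adj a b ∧ s(a, b) ≠ s(v, w)) ∨ s(a, b) = s(s, v) := by
  simp only [rotate, SimpleGraph.sup_adj, SimpleGraph.deleteEdges_adj, Set.mem_singleton_iff,
    SimpleGraph.edge_adj, Sym2.eq_iff]
  grind

open SimpleGraph in
theorem rotate_isAcyclic {V : Type*} {H : SimpleGraph V} (hH : H.IsAcyclic) {s v w : V}
    (h : ¬ (H.deleteEdges {s(v, w)}).Reachable s v) : (rotate H s v w).IsAcyclic :=
  (hH.anti (deleteEdges_le _)).sup_edge_of_not_reachable h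

/-- A Pósa rotation exists at every `v` that is not isolated; moreover the new end can be kept in a
component other than that of a given vertex `r ≠ v`, provided `v` has two neighbours. -/
theorem exists_rotation {V : Type*} {H : SimpleGraph V} (hH : H.IsAcyclic) {s v : V}
    {root : Set V} (hroot : root.Subsingleton) (hsv : s ≠ v)
    (hs : ∀ r ∈ root, ¬ H.Reachable s r) (hv : ∃ w, H.Adj v w)
    (hv' : ∀ r ∈ root, v ≠ r ∧ ∃ w₁ w₂, w₁ ≠ w₂ ∧ H.Adj v w₁ ∧ H.Adj v w₂) :
    ∃ w, H.Adj v w ∧ (rotate H s v w).IsAcyclic ∧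
      ∀ r ∈ root, ¬ (rotate H s v w).Reachable w r := by
  classical
  by_cases hr : H.Reachable v s
  -- Same component: the edge to cut is the one leaving `v` towards `s`, so that `sv` reconnects the
  -- two pieces.
  · obtain ⟨p, hp⟩ := hr.exists_isPath
    cases p with
    | nil => exact absurd rfl hsv
    | @cons _ w _ hvw q =>
      rw [SimpleGraph.Walk.cons_isPath_iff] at hp
      have hws : (H.deleteEdges {s(v, w)}).Reachable w s := by
        refine ⟨q.toDeleteEdges _ fun e he h => ?_⟩
        rw [Set.mem_singleton_iff] at h
        subst h
        exact hp.2 (q.fst_mem_support_of_mem_edges he)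
      refine ⟨w, hvw, rotate_isAcyclic hH fun h =>
        hH.not_reachable_deleteEdges hvw (hws.trans h).symm, fun r hr' => ?_⟩
      refine SimpleGraph.not_reachable_of_closed (T := {a | H.Reachable s a}) ?_ ?_ (hs r hr')
      · intro a b hab ha
        rcases (rotate_adj hsv).1 hab with h | h
        · exact SimpleGraph.Reachable.trans ha h.1.reachable
        · rcases Sym2.eq_iff.1 h with ⟨rfl, rfl⟩ | ⟨rfl, rfl⟩
          · exact hr.symm
          · exact SimpleGraph.Reachable.refl _
      · exact hr.symm.trans hvw.reachable
  · obtain ⟨w, hw, hwr⟩ : ∃ w, H.Adj v w ∧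
        ∀ r ∈ root, ¬ (H.deleteEdges {s(v, w)}).Reachable w r := by
      rcases root.eq_empty_or_nonempty with rfl | ⟨r, hr'⟩
      · obtain ⟨w, hw⟩ := hv
        exact ⟨w, hw, by simp⟩
      obtain ⟨hvr, w₁, w₂, hne, h₁, h₂⟩ := hv' r hr'
      by_cases hvr' : H.Reachable v r
      · obtain ⟨p, hp⟩ := hvr'.exists_isPath
        -- A path from `v` uses only one edge at `v`, so one of the two neighbours can be cut off
        -- without separating `v` from `r`.
        obtain ⟨w, hw, hwp⟩ : ∃ w, H.Adj v w ∧ s(v, w) ∉ p.edges := by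
          by_cases h : s(v, w₁) ∈ p.edges
          · refine ⟨w₂, h₂, fun h' => hne ?_⟩
            rw [hp.eq_snd_of_mem_edges h, hp.eq_snd_of_mem_edges h']
          · exact ⟨w₁, h₁, h⟩
        refine ⟨w, hw, fun r' hr'' h => ?_⟩
        obtain rfl := hroot hr' hr''
        have : (H.deleteEdges {s(v, w)}).Reachable v r :=
          ⟨p.toDeleteEdges _ fun e he h => hwp (by rw [Set.mem_singleton_iff] at h; exact h ▸ he)⟩
        exact hH.not_reachable_deleteEdges hw (this.trans h.symm)
      · refine ⟨w₁, h₁, fun r' hr'' h => hvr' ?_⟩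
        obtain rfl := hroot hr' hr''
        exact h₁.reachable.trans (h.mono (SimpleGraph.deleteEdges_le _))
    refine ⟨w, hw, rotate_isAcyclic hH fun h =>
      hr (h.mono (SimpleGraph.deleteEdges_le _)).symm, fun r hr' => ?_⟩
    refine SimpleGraph.not_reachable_of_closed
      (T := {a | (H.deleteEdges {s(v, w)}).Reachable w a}) ?_ (SimpleGraph.Reachable.refl _)
      (hwr r hr')
    intro a b hab ha
    rcases (rotate_adj hsv).1 hab with h | h
    · refine SimpleGraph.Reachable.trans ha (SimpleGraph.Adj.reachable ?_)
      rw [SimpleGraph.deleteEdges_adj]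
      simpa using h
    · exfalso
      rcases Sym2.eq_iff.1 h with ⟨rfl, rfl⟩ | ⟨rfl, rfl⟩
      · exact hr (hw.reachable.trans (SimpleGraph.Reachable.mono (SimpleGraph.deleteEdges_le _) ha))
      · exact hH.not_reachable_deleteEdges hw (SimpleGraph.Reachable.symm ha)

/-- The number of neighbours of `v`. -/
noncomputable def deg {V : Type*} (H : SimpleGraph V) (v : V) : ℕ := (H.neighborSet v).ncard

open Classical in
theorem deg_sup_edge {V : Type*} [Finite V] {H : SimpleGraph V} {a b : V} (hab : a ≠ b)
    (h : ¬ H.Adj a b) (z : V) :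
    deg (H ⊔ SimpleGraph.edge a b) z =
      deg H z + (if z = a then 1 else 0) + (if z = b then 1 else 0) := by
  unfold deg
  by_cases hza : z = a
  · subst hza
    have : (H ⊔ SimpleGraph.edge z b).neighborSet z = insert b (H.neighborSet z) := by
      ext c
      simp only [SimpleGraph.mem_neighborSet, SimpleGraph.sup_adj, SimpleGraph.edge_adj,
        Set.mem_insert_iff]
      grind
    rw [this, Set.ncard_insert_of_notMem (by simpa using h)]
    simp [hab]
  by_cases hzb : z = b
  · subst hzb
    have : (H ⊔ SimpleGraph.edge a z).neighborSet z = insert a (H.neighborSet z) := by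
      ext c
      simp only [SimpleGraph.mem_neighborSet, SimpleGraph.sup_adj, SimpleGraph.edge_adj,
        Set.mem_insert_iff]
      grind
    rw [this, Set.ncard_insert_of_notMem (by simpa [H.adj_comm] using h)]
    simp [hza]
  · have : (H ⊔ SimpleGraph.edge a b).neighborSet z = H.neighborSet z := by
      ext c
      simp only [SimpleGraph.mem_neighborSet, SimpleGraph.sup_adj, SimpleGraph.edge_adj]
      grind
    simp [this, hza, hzb]

open Classical in
theorem deg_deleteEdges {V : Type*} [Finite V] {H : SimpleGraph V} {a b : V}
    (h : H.Adj a b) (z : V) :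
    deg (H.deleteEdges {s(a, b)}) z + (if z = a then 1 else 0) + (if z = b then 1 else 0) =
      deg H z := by
  rw [← deg_sup_edge h.ne (by simp)]
  congr 1
  ext c d
  simp only [SimpleGraph.sup_adj, SimpleGraph.deleteEdges_adj, Set.mem_singleton_iff,
    SimpleGraph.edge_adj, Sym2.eq_iff]
  grind [SimpleGraph.Adj.symm, SimpleGraph.Adj.ne]

open Classical in
theorem deg_rotate {V : Type*} [Finite V] {H : SimpleGraph V} {s v w : V} (hsv : s ≠ v)
    (h : ¬ H.Adj s v) (hvw : H.Adj v w) (z : V) :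
    deg (rotate H s v w) z + (if z = w then 1 else 0) =
      deg H z + (if z = s then 1 else 0) := by
  rw [rotate, deg_sup_edge hsv (by simp [h]), ← deg_deleteEdges hvw z]
  ring

theorem edgeSet_rotate_symmDiff {V : Type*} {H : SimpleGraph V} {s v w : V} (hsv : s ≠ v) :
    symmDiff H.edgeSet (rotate H s v w).edgeSet ⊆ {s(s, v), s(v, w)} := by
  intro e
  induction e using Sym2.ind with
  | _ a b =>
    simp only [Set.mem_symmDiff, SimpleGraph.mem_edgeSet, rotate_adj hsv, Set.mem_insert_iff,
      Set.mem_singleton_iff]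
    grind

theorem ncard_symmDiff_trans {V : Type*} [Finite V] (A B C : Set (Sym2 V)) :
    (symmDiff A C).ncard ≤ (symmDiff A B).ncard + (symmDiff B C).ncard :=
  (Set.ncard_le_ncard (symmDiff_triangle A B C) (Set.toFinite _)).trans (Set.ncard_union_le _ _)

/-! ### Sequences of rotations and growth of the set of ends -/

/-- The vertices with a neighbour in `X`. -/
def nbhd {V : Type*} (G : SimpleGraph V) (X : Set V) : Set V := {v | ∃ u ∈ X, G.Adj u v}

theorem nbhd_mono {V : Type*} {G : SimpleGraph V} {X Y : Set V} (h : X ⊆ Y) :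
    nbhd G X ⊆ nbhd G Y := fun _ ⟨u, hu, huv⟩ => ⟨u, h hu, huv⟩

/-- `Rotates G H₀ U root s₀ k H s`: the forest `H` with marked end `s` arises from `H₀` with marked
end `s₀` by `k` rotations at vertices of `U`, and the marked end is never connected to `root`. -/
inductive Rotates {V : Type*} (G H₀ : SimpleGraph V) (U root : Set V) (s₀ : V) :
    ℕ → SimpleGraph V → V → Prop
  | refl : Rotates G H₀ U root s₀ 0 H₀ s₀
  | step {k : ℕ} {H : SimpleGraph V} {s v w : V} : Rotates G H₀ U root s₀ k H s → G.Adj s v →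
      ¬ H.Adj s v → v ∈ U → H.Adj v w → H₀.Adj v w → (rotate H s v w).IsAcyclic →
      (∀ r ∈ root, ¬ (rotate H s v w).Reachable w r) →
      Rotates G H₀ U root s₀ (k + 1) (rotate H s v w) w

namespace Rotates

variable {V : Type*} {G H₀ H : SimpleGraph V} {U root : Set V} {s₀ s : V} {k : ℕ}

theorem isAcyclic (h : Rotates G H₀ U root s₀ k H s) (h₀ : H₀.IsAcyclic) : H.IsAcyclic := by
  cases h with
  | refl => exact h₀
  | step _ _ _ _ _ _ h _ => exact h

theorem not_reachable (h : Rotates G H₀ U root s₀ k H s)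
    (h₀ : ∀ r ∈ root, ¬ H₀.Reachable s₀ r) : ∀ r ∈ root, ¬ H.Reachable s r := by
  cases h with
  | refl => exact h₀
  | step _ _ _ _ _ _ _ h => exact h

theorem le (h : Rotates G H₀ U root s₀ k H s) (h₀ : H₀ ≤ G) : H ≤ G := by
  induction h with
  | refl => exact h₀
  | step _ hsv _ _ _ _ _ _ ih =>
    intro a b hab
    rcases (rotate_adj hsv.ne).1 hab with h | h
    · exact ih h.1
    · rcases Sym2.eq_iff.1 h with ⟨rfl, rfl⟩ | ⟨rfl, rfl⟩
      · exact hsv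
      · exact hsv.symm

-- The marked end carries a deficit of one degree, which each rotation moves along. It may thus
-- become isolated on the way; a later edge repairs this.
open Classical in
theorem deg_eq [Finite V] (h : Rotates G H₀ U root s₀ k H s) (z : V) :
    deg H z + (if z = s then 1 else 0) = deg H₀ z + (if z = s₀ then 1 else 0) := by
  induction h with
  | refl => rfl
  | step _ hsv hn _ hvw _ _ _ ih => rw [deg_rotate hsv.ne hn hvw, ih]

theorem ncard_symmDiff_le [Finite V] (h : Rotates G H₀ U root s₀ k H s) :
    (symmDiff H₀.edgeSet H.edgeSet).ncard ≤ 2 * k := by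
  induction h with
  | refl => simp
  | step _ hsv _ _ _ _ _ _ ih =>
    refine (ncard_symmDiff_trans _ _ _).trans (add_le_add ih
      (((Set.ncard_le_ncard (edgeSet_rotate_symmDiff hsv.ne) (Set.toFinite _)).trans ?_)))
    exact (Set.ncard_insert_le _ _).trans (by simp)

/-- A rotation alters adjacency only at `s`, `v` and `w`. This locates the components left intact by
rotations that are not confined to a region. -/
theorem exists_touched [Finite V] (h : Rotates G H₀ U root s₀ k H s) :
    ∃ L : Set V, L.ncard ≤ 3 * k ∧ ∀ a, a ∉ L → ∀ b, H.Adj a b ↔ H₀.Adj a b := by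
  induction h with
  | refl => exact ⟨∅, by simp⟩
  | @step k H s v w _ hsv _ _ _ _ _ _ ih =>
    obtain ⟨L, hL, hadj⟩ := ih
    refine ⟨L ∪ {s, v, w}, (Set.ncard_union_le _ _).trans (add_le_add hL ?_), fun a ha b => ?_⟩
    · exact (Set.ncard_insert_le _ _).trans
        (Nat.succ_le_succ ((Set.ncard_insert_le _ _).trans (by simp)))
    · simp only [Set.mem_union, Set.mem_insert_iff, Set.mem_singleton_iff, not_or] at ha
      rw [rotate_adj hsv.ne, ← hadj a ha.1 b]
      grind

/-- Since rotations break only edges of `H₀`, every new end is an `H₀`-neighbour of a vertex of `U`;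
invariants of the ends follow without induction. -/
theorem mem_of_step {P : Set V} (h : Rotates G H₀ U root s₀ k H s) (h₀ : s₀ ∈ P)
    (hP : ∀ v ∈ U, ∀ w, H₀.Adj v w → w ∈ P) : s ∈ P := by
  cases h with
  | refl => exact h₀
  | step _ _ _ hv _ hvw _ _ => exact hP _ hv _ hvw

/-- Rotations within a union `T` of components change nothing outside `T`. -/
theorem adj_iff_of_notMem {T : Set V} (h : Rotates G H₀ U root s₀ k H s) (h₀ : s₀ ∈ T)
    (hU : U ⊆ T) (hT : ∀ a b, H₀.Adj a b → a ∈ T → b ∈ T) :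
    ∀ a, a ∉ T → ∀ b, H.Adj a b ↔ H₀.Adj a b := by
  induction h with
  | refl => simp
  | @step k H s v w h' hsv _ hv _ hvw _ _ ih =>
    intro a ha b
    have hs : s ∈ T := h'.mem_of_step h₀ fun v hv w hvw => hT v w hvw (hU hv)
    have hw : w ∈ T := hT v w hvw (hU hv)
    rw [rotate_adj hsv.ne, ← ih a ha b]
    have := hU hv
    grind

/-- A vertex keeps its neighbours as long as neither it nor a neighbour has been the end. -/
theorem adj_iff_of_untouched {S : Set V}
    (h : Rotates G H₀ U root s₀ k H s)
    (hS : ∀ j ≤ k, ∀ H' s', Rotates G H₀ U root s₀ j H' s' → s' ∈ S) {a : V} (ha : a ∉ S)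
    (ha' : a ∉ nbhd H₀ S) (b : V) : H.Adj a b ↔ H₀.Adj a b := by
  induction h with
  | refl => rfl
  | @step k H s v w h' hsv hn hv hvw hvw' hac hr ih =>
    have hs : s ∈ S := hS k (Nat.le_succ k) _ _ h'
    have hw : w ∈ S := hS (k + 1) le_rfl _ _ (h'.step hsv hn hv hvw hvw' hac hr)
    rw [rotate_adj hsv.ne, ← ih fun j hj => hS j (hj.trans (Nat.le_succ k))]
    have h1 : a ≠ s := fun h => ha (h ▸ hs)
    have h2 : a ≠ w := fun h => ha (h ▸ hw)
    have h3 : a ≠ v := fun h => ha' ⟨w, hw, h ▸ hvw'.symm⟩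
    grind

end Rotates

/-- The ends that can be reached with at most `k` rotations. -/
def rotationEnds {V : Type*} (G H₀ : SimpleGraph V) (U root : Set V) (s₀ : V) (k : ℕ) : Set V :=
  {s | ∃ j ≤ k, ∃ H, Rotates G H₀ U root s₀ j H s}

theorem rotationEnds_mono {V : Type*} {G H₀ : SimpleGraph V} {U root : Set V} {s₀ : V} {k l : ℕ}
    (h : k ≤ l) : rotationEnds G H₀ U root s₀ k ⊆ rotationEnds G H₀ U root s₀ l :=
  fun _ ⟨j, hj, H, hH⟩ => ⟨j, hj.trans h, H, hH⟩

/-- Pósa's lemma. If neither `v` nor any of its `H₀`-neighbours has been an end, the edges at `v`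
are still those of `H₀`, so a rotation at `v` succeeds and turns an `H₀`-neighbour of `v` into an
end. With maximum degree 2, the left side has at most three times as many elements as the next set
of ends. -/
theorem nbhd_rotationEnds_subset {V : Type*} {G H₀ : SimpleGraph V} {U root : Set V} {s₀ : V}
    {k : ℕ} (hac : H₀.IsAcyclic) (hroot : root.Subsingleton)
    (hs₀ : ∀ r ∈ root, ¬ H₀.Reachable s₀ r) (hU : ∀ v ∈ U, ∃ w, H₀.Adj v w)
    (hU' : ∀ v ∈ U, ∀ r ∈ root, v ≠ r ∧ ∃ w₁ w₂, w₁ ≠ w₂ ∧ H₀.Adj v w₁ ∧ H₀.Adj v w₂) :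
    nbhd G (rotationEnds G H₀ U root s₀ k) ∩ U ⊆
      rotationEnds G H₀ U root s₀ (k + 1) ∪ nbhd H₀ (rotationEnds G H₀ U root s₀ (k + 1)) := by
  rintro v ⟨⟨s, hs, hsv⟩, hv⟩
  by_cases h1 : v ∈ rotationEnds G H₀ U root s₀ k
  · exact Or.inl (rotationEnds_mono (Nat.le_succ k) h1)
  by_cases h2 : v ∈ nbhd H₀ (rotationEnds G H₀ U root s₀ k)
  · exact Or.inr (nbhd_mono (rotationEnds_mono (Nat.le_succ k)) h2)
  obtain ⟨j, hj, H, hH⟩ := id hs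
  have hadj := fun b => hH.adj_iff_of_untouched (S := rotationEnds G H₀ U root s₀ k)
    (fun i hi H' s' h' => ⟨i, hi.trans hj, H', h'⟩) h1 h2 b
  have hn : ¬ H.Adj s v := fun h => h2 ⟨s, hs, ((hadj s).1 h.symm).symm⟩
  obtain ⟨w, hw, hacw, hr⟩ := exists_rotation (hH.isAcyclic hac) hroot hsv.ne
    (hH.not_reachable hs₀) (by simpa only [hadj] using hU v hv)
    (by simpa only [hadj] using hU' v hv)
  exact Or.inr ⟨w, ⟨j + 1, Nat.succ_le_succ hj, _,
    hH.step hsv hn hv hw ((hadj w).1 hw) hacw hr⟩, ((hadj w).1 hw).symm⟩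

theorem ncard_nbhd_le {V : Type*} [Finite V] {H : SimpleGraph V} (hdeg : ∀ v, deg H v ≤ 2)
    (X : Set V) : (nbhd H X).ncard ≤ 2 * X.ncard := by
  classical
  have : Fintype V := Fintype.ofFinite V
  have h : nbhd H X = ⋃ u ∈ X.toFinset, H.neighborSet u := by
    ext v; simp [nbhd]
  rw [h]
  refine (Finset.set_ncard_biUnion_le _ _).trans ((Finset.sum_le_card_nsmul _ _ 2
    fun u _ => hdeg u).trans ?_)
  rw [smul_eq_mul, mul_comm, Set.ncard_eq_toFinset_card']

/-- If the marked end always expands into the vertices where rotations are allowed, then many ends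
are reachable after logarithmically many rotations. -/
theorem le_ncard_rotationEnds {V : Type*} [Finite V] {G H₀ : SimpleGraph V} {U root P : Set V}
    {s₀ : V} {k g : ℕ} {μ : ℝ} (hac : H₀.IsAcyclic) (hroot : root.Subsingleton)
    (hdeg : ∀ v, deg H₀ v ≤ 2)
    (hs₀ : ∀ r ∈ root, ¬ H₀.Reachable s₀ r) (hU : ∀ v ∈ U, ∃ w, H₀.Adj v w)
    (hU' : ∀ v ∈ U, ∀ r ∈ root, v ≠ r ∧ ∃ w₁ w₂, w₁ ≠ w₂ ∧ H₀.Adj v w₁ ∧ H₀.Adj v w₂)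
    (hP₀ : s₀ ∈ P) (hP : ∀ v ∈ U, ∀ w, H₀.Adj v w → w ∈ P)
    (hexp : ∀ X ⊆ P, (X.ncard : ℝ) < μ → 3 * g * X.ncard ≤ (nbhd G X ∩ U).ncard)
    (hk : μ ≤ (g : ℝ) ^ k) : μ ≤ (rotationEnds G H₀ U root s₀ k).ncard := by
  -- Below `μ`, each round multiplies the number of ends by `g`; the factor 3 in `hexp` pays for the
  -- ends together with their `H₀`-neighbours.
  have key : ∀ j, μ ≤ (rotationEnds G H₀ U root s₀ j).ncard ∨
      g ^ j ≤ (rotationEnds G H₀ U root s₀ j).ncard := by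
    intro j
    induction j with
    | zero =>
      right
      rw [pow_zero]
      exact (Set.ncard_pos).2 ⟨s₀, 0, le_rfl, H₀, .refl⟩
    | succ j ih =>
      have hmono := Set.ncard_le_ncard (rotationEnds_mono (G := G) (H₀ := H₀) (U := U)
        (root := root) (s₀ := s₀) (Nat.le_succ j)) (Set.toFinite _)
      rcases lt_or_ge ((rotationEnds G H₀ U root s₀ j).ncard : ℝ) μ with hlt | hge
      · right
        have h1 := hexp (rotationEnds G H₀ U root s₀ j)
          (fun s ⟨_, _, _, h⟩ => h.mem_of_step hP₀ hP) hlt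
        have h2 := (Set.ncard_le_ncard (nbhd_rotationEnds_subset (G := G) (k := j) hac hroot hs₀
          hU hU') (Set.toFinite _)).trans (Set.ncard_union_le _ _)
        have h3 := ncard_nbhd_le hdeg (rotationEnds G H₀ U root s₀ (j + 1))
        have h4 := ih.resolve_left (not_le.2 hlt)
        have h5 : g * g ^ j ≤ g * (rotationEnds G H₀ U root s₀ j).ncard :=
          Nat.mul_le_mul_left g h4
        rw [pow_succ']
        nlinarith
      · left
        exact hge.trans (by exact_mod_cast hmono)
  rcases key k with h | h
  · exact h
  · exact hk.trans (by exact_mod_cast h)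

/-! ### Exceptional sets in an expander -/

/-- In an expander every large target set `W` has a small exceptional set `Y` such that all small
sets avoiding `Y` expand into `W` outside the neighbourhood of `Y`. -/
theorem exists_exceptional_set {V : Type*} [Fintype V] {C : ℝ} {G : SimpleGraph V}
    (hC : 10 ^ 10 < C) (hG : IsExpander C G) {W : Set V}
    (hW : (Fintype.card V : ℝ) / 1000 ≤ W.ncard) :
    ∃ Y : Set V, (Y.ncard : ℝ) < (Fintype.card V : ℝ) / (2 * C) ∧
      ∀ X : Set V, Disjoint X Y → (X.ncard : ℝ) < (Fintype.card V : ℝ) / (2 * C) →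
        10 ^ 6 * X.ncard ≤ ((nbhd G X ∩ W) \ nbhd G Y).ncard := by
  set n : ℝ := (Fintype.card V : ℝ) with hn
  set μ : ℝ := n / (2 * C) with hμ
  have hn3 : (3 : ℝ) ≤ n := by rw [hn]; exact_mod_cast hG.three_le
  have hC0 : 0 < 2 * C := by linarith
  have hμ0 : 0 < μ := by positivity
  have hnμ : n = 2 * C * μ := by rw [hμ]; field_simp
  have hbig : 2 * 10 ^ 10 * μ < n := by rw [hnμ]; nlinarith
  -- Take a largest badly expanding set. The bound `2 * μ` leaves room to adjoin a further bad set
  -- `X` of size below `μ`, which contradicts maximality.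
  obtain ⟨Y, ⟨hY, hYW⟩, hmax⟩ := Set.exists_max_image
    {Y : Set V | (Y.ncard : ℝ) ≤ 2 * μ ∧ (nbhd G Y ∩ W).ncard ≤ 10 ^ 6 * Y.ncard}
    Set.ncard (Set.toFinite _) ⟨∅, by simp [hμ0.le], by simp [nbhd]⟩
  have hYμ : (Y.ncard : ℝ) < μ := by
    by_contra! hge
    -- A set of size at least `μ` reaches all but fewer than `μ` of the remaining vertices, so `W`
    -- would have fewer than `n/1000` elements.
    have hZ : ((Y ∪ nbhd G Y)ᶜ.ncard : ℝ) < μ := by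
      by_contra! hge'
      obtain ⟨y, hy, z, hz, hyz⟩ := hG.joined Y (Y ∪ nbhd G Y)ᶜ
        (Set.disjoint_left.2 fun a ha h => h (Or.inl ha)) hge hge'
      exact hz (Or.inr ⟨y, hy, hyz⟩)
    have hsub : W ⊆ (Y ∪ nbhd G Y)ᶜ ∪ (Y ∪ (nbhd G Y ∩ W)) := by
      intro a ha
      simp only [Set.mem_union, Set.mem_compl_iff, Set.mem_inter_iff]
      tauto
    have h1 := (Set.ncard_le_ncard hsub (Set.toFinite _)).trans (Set.ncard_union_le _ _)
    have h2 := Set.ncard_union_le Y (nbhd G Y ∩ W)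
    have h3 : (W.ncard : ℝ) ≤ (Y ∪ nbhd G Y)ᶜ.ncard + (Y.ncard + 10 ^ 6 * Y.ncard) := by
      exact_mod_cast h1.trans (Nat.add_le_add_left (h2.trans (Nat.add_le_add_left hYW _)) _)
    linarith
  refine ⟨Y, hYμ, fun X hXY hX => ?_⟩
  by_contra! hlt
  have hcard : (Y ∪ X).ncard = Y.ncard + X.ncard := Set.ncard_union_eq hXY.symm
  have hsub : nbhd G (Y ∪ X) ∩ W ⊆ (nbhd G Y ∩ W) ∪ ((nbhd G X ∩ W) \ nbhd G Y) := by
    rintro v ⟨⟨u, hu, huv⟩, hv⟩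
    by_cases h : v ∈ nbhd G Y
    · exact Or.inl ⟨h, hv⟩
    · exact Or.inr ⟨⟨⟨u, hu.resolve_left fun h' => h ⟨u, h', huv⟩, huv⟩, hv⟩, h⟩
  have h1 := (Set.ncard_le_ncard hsub (Set.toFinite _)).trans (Set.ncard_union_le _ _)
  have h2 := hmax (Y ∪ X) ⟨by rw [hcard]; push_cast; linarith, by rw [hcard]; linarith⟩
  have h3 : X.ncard = 0 := by omega
  simp [h3] at hlt

/-! ### Unions of components and their inner vertices -/

/-- `T` is a union of components of `F`. -/
def ClosedUnder {V : Type*} (F : SimpleGraph V) (T : Set V) : Prop :=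
  ∀ a b, F.Adj a b → a ∈ T → b ∈ T

namespace ClosedUnder

variable {V : Type*} {F : SimpleGraph V} {S T : Set V}

theorem compl (h : ClosedUnder F T) : ClosedUnder F Tᶜ :=
  fun a b hab ha hb => ha (h b a hab.symm hb)

theorem union (hS : ClosedUnder F S) (hT : ClosedUnder F T) : ClosedUnder F (S ∪ T) :=
  fun a b hab ha => ha.imp (hS a b hab) (hT a b hab)

theorem diff (hS : ClosedUnder F S) (hT : ClosedUnder F T) : ClosedUnder F (S \ T) :=
  fun a b hab ha => ⟨hS a b hab ha.1, hT.compl a b hab ha.2⟩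

theorem mem_of_reachable (hT : ClosedUnder F T) {a b : V} (h : F.Reachable a b) (ha : a ∈ T) :
    b ∈ T := by
  by_contra hb
  exact SimpleGraph.not_reachable_of_closed hT ha hb h

end ClosedUnder

theorem closedUnder_reachable {V : Type*} (F : SimpleGraph V) (v : V) :
    ClosedUnder F {z | F.Reachable v z} :=
  fun _ _ hab ha => SimpleGraph.Reachable.trans ha hab.reachable

theorem ncard_reachable_le {V : Type*} [Fintype V] (F : SimpleGraph V) (v : V) :
    {z | F.Reachable v z}.ncard ≤ pathLength F v + 1 := by
  have h := (F.connectedComponentMk v).connected_toSimpleGraph.card_vert_le_card_edgeSet_add_one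
  have h2 : {z | F.Reachable v z} = (F.connectedComponentMk v).supp := by
    ext z
    simp [SimpleGraph.ConnectedComponent.mem_supp_iff, SimpleGraph.reachable_comm]
  rw [h2]
  exact h

theorem closedUnder_pathLength {V : Type*} [Fintype V] (F : SimpleGraph V) (p : ℕ → Prop) :
    ClosedUnder F {v | p (pathLength F v)} := by
  intro a b hab ha
  have : F.connectedComponentMk a = F.connectedComponentMk b :=
    SimpleGraph.ConnectedComponent.sound hab.reachable
  simp only [Set.mem_ofPred_eq, pathLength] at ha ⊢
  rwa [← this]

/-- On a path with at least two edges the neighbour of an end is an inner vertex. -/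
theorem exists_adj_deg_ne_one {V : Type*} [Fintype V] {F : SimpleGraph V} {v : V}
    (hdeg : deg F v = 1) (hlen : 2 ≤ pathLength F v) : ∃ w, F.Adj v w ∧ deg F w ≠ 1 := by
  classical
  obtain ⟨w, hw⟩ := Set.ncard_eq_one.1 hdeg
  have hvw : F.Adj v w := by
    have : w ∈ F.neighborSet v := by rw [hw]; rfl
    exact this
  refine ⟨w, hvw, fun h => ?_⟩
  obtain ⟨u, hu⟩ := Set.ncard_eq_one.1 h
  have huv : v = u := by
    have : v ∈ F.neighborSet w := hvw.symm
    rw [hu] at this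
    exact this
  subst huv
  have hcl : ClosedUnder F {v, w} := by
    intro a b hab ha
    rcases ha with rfl | rfl
    · have : b ∈ F.neighborSet a := hab
      rw [hw] at this
      exact Or.inr this
    · have : b ∈ F.neighborSet a := hab
      rw [hu] at this
      exact Or.inl this
  have hsub : (F.connectedComponentMk v).supp ⊆ {v, w} := fun z hz =>
    hcl.mem_of_reachable (SimpleGraph.ConnectedComponent.exact hz).symm (Or.inl rfl)
  have hc : Fintype.card (F.connectedComponentMk v) ≤ 2 := by
    have h1 := (Set.ncard_le_ncard hsub (Set.toFinite _)).trans (Set.ncard_insert_le _ _)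
    rw [Set.ncard_singleton] at h1
    rw [← Nat.card_eq_fintype_card]
    exact h1
  have h1 := (F.connectedComponentMk v).toSimpleGraph.card_edgeFinset_le_card_choose_two
  have h2 : pathLength F v = (F.connectedComponentMk v).toSimpleGraph.edgeFinset.card := by
    rw [pathLength, ← SimpleGraph.coe_edgeFinset, Set.ncard_coe_finset]
  have h3 := Nat.choose_le_choose 2 hc
  simp only [Nat.choose_self] at h3
  omega

/-- Every endpoint in `M` is adjacent to an inner vertex, and an inner vertex has only two
neighbours. -/
theorem ncard_le_three_mul_inner {V : Type*} [Fintype V] {F : SimpleGraph V} {M : Set V}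
    (hM : ClosedUnder F M) (hlen : ∀ v ∈ M, 2 ≤ pathLength F v) (h1 : ∀ v, 1 ≤ deg F v)
    (h2 : ∀ v, deg F v ≤ 2) : M.ncard ≤ 3 * (M ∩ {v | deg F v = 2}).ncard := by
  have hsub : M ⊆ (M ∩ {v | deg F v = 2}) ∪ nbhd F (M ∩ {v | deg F v = 2}) := by
    intro v hv
    by_cases h : deg F v = 2
    · exact Or.inl ⟨hv, h⟩
    have h1v := h1 v
    have h2v := h2 v
    obtain ⟨w, hw, hw'⟩ := exists_adj_deg_ne_one (v := v) (by omega) (hlen v hv)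
    have h1w := h1 w
    have h2w := h2 w
    exact Or.inr ⟨w, ⟨hM _ _ hw hv, show deg F w = 2 by omega⟩, hw.symm⟩
  have h := (Set.ncard_le_ncard hsub (Set.toFinite _)).trans (Set.ncard_union_le _ _)
  have := ncard_nbhd_le h2 (M ∩ {v | deg F v = 2})
  omega

/-- A union of small components contains a union of components of roughly prescribed weight. -/
theorem exists_closedUnder_subset {V : Type*} [Fintype V] {F : SimpleGraph V} {M I : Set V}
    {b t : ℝ} (hM : ClosedUnder F M) (hb : ∀ v ∈ M, ({z | F.Reachable v z}.ncard : ℝ) ≤ b)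
    (hb0 : 0 ≤ b) (ht : 0 ≤ t) (hMt : t ≤ (M ∩ I).ncard) :
    ∃ A ⊆ M, ClosedUnder F A ∧ t ≤ (A ∩ I).ncard ∧ ((A ∩ I).ncard : ℝ) ≤ t + b := by
  -- In a minimal such union, dropping one component brings the weight below `t`, so the excess is
  -- at most the size of that component.
  obtain ⟨A, ⟨hAM, hA, hAt⟩, hmin⟩ := Set.exists_min_image
    {A : Set V | A ⊆ M ∧ ClosedUnder F A ∧ t ≤ (A ∩ I).ncard} Set.ncard (Set.toFinite _)
    ⟨M, subset_rfl, hM, hMt⟩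
  refine ⟨A, hAM, hA, hAt, ?_⟩
  rcases A.eq_empty_or_nonempty with rfl | ⟨a, ha⟩
  · simpa using by linarith
  set K := {z | F.Reachable a z} with hK
  have hlt : (A \ K).ncard < A.ncard :=
    Set.ncard_lt_ncard ⟨Set.sdiff_subset, fun h => (h ha).2 (SimpleGraph.Reachable.refl a)⟩
  have hnot : ((A \ K ∩ I).ncard : ℝ) < t := by
    by_contra! h
    exact absurd (hmin _ ⟨Set.sdiff_subset.trans hAM, hA.diff (closedUnder_reachable F a), h⟩)
      (not_le.2 hlt)
  have hsub : A ∩ I ⊆ (A \ K ∩ I) ∪ K := by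
    rintro z ⟨hz, hzI⟩
    by_cases h : z ∈ K
    · exact Or.inr h
    · exact Or.inl ⟨⟨hz, h⟩, hzI⟩
  have h1 : ((A ∩ I).ncard : ℝ) ≤ (A \ K ∩ I).ncard + K.ncard := by
    exact_mod_cast (Set.ncard_le_ncard hsub (Set.toFinite _)).trans (Set.ncard_union_le _ _)
  linarith [hb a (hAM ha)]

/-- The components within `A` that do not meet `L`. -/
def avoiding {V : Type*} (F : SimpleGraph V) (A L : Set V) : Set V :=
  {z ∈ A | ∀ d ∈ L, ¬ F.Reachable d z}

theorem closedUnder_avoiding {V : Type*} {F : SimpleGraph V} {A : Set V} (hA : ClosedUnder F A)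
    (L : Set V) : ClosedUnder F (avoiding F A L) :=
  fun a b hab ha => ⟨hA a b hab ha.1, fun d hd h => ha.2 d hd (h.trans hab.symm.reachable)⟩

theorem avoiding_subset {V : Type*} {F : SimpleGraph V} {A L : Set V} : avoiding F A L ⊆ A :=
  fun _ h => h.1

theorem notMem_of_mem_avoiding {V : Type*} {F : SimpleGraph V} {A L : Set V} {v : V}
    (h : v ∈ avoiding F A L) : v ∉ L :=
  fun hv => h.2 v hv (SimpleGraph.Reachable.refl v)

/-- Each vertex of `L` spoils at most one component of `A`, hence at most `b` vertices. -/
theorem ncard_le_ncard_avoiding {V : Type*} [Fintype V] {F : SimpleGraph V} {A I L : Set V}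
    {b : ℝ} (hA : ClosedUnder F A) (hb : ∀ v ∈ A, ({z | F.Reachable v z}.ncard : ℝ) ≤ b)
    (hb0 : 0 ≤ b) :
    ((A ∩ I).ncard : ℝ) ≤ (avoiding F A L ∩ I).ncard + L.ncard * b := by
  classical
  have hsub : A ∩ I ⊆ (avoiding F A L ∩ I) ∪ ⋃ d ∈ (L ∩ A).toFinset, {z | F.Reachable d z} := by
    rintro z ⟨hz, hzI⟩
    by_cases h : ∃ d ∈ L, F.Reachable d z
    · obtain ⟨d, hd, hdz⟩ := h
      exact Or.inr (Set.mem_biUnion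
        (by simpa using ⟨hd, hA.mem_of_reachable hdz.symm hz⟩) hdz)
    · push Not at h
      exact Or.inl ⟨⟨hz, h⟩, hzI⟩
  have h1 : ((⋃ d ∈ (L ∩ A).toFinset, {z | F.Reachable d z}).ncard : ℝ) ≤ L.ncard * b := by
    calc ((⋃ d ∈ (L ∩ A).toFinset, {z | F.Reachable d z}).ncard : ℝ)
        ≤ ∑ d ∈ (L ∩ A).toFinset, ({z | F.Reachable d z}.ncard : ℝ) := by
          exact_mod_cast Finset.set_ncard_biUnion_le _ _
      _ ≤ (L ∩ A).toFinset.card • b :=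
          Finset.sum_le_card_nsmul _ _ _ fun d hd => hb d (Set.mem_toFinset.1 hd).2
      _ ≤ L.ncard * b := by
          rw [nsmul_eq_mul, ← Set.ncard_eq_toFinset_card']
          exact mul_le_mul_of_nonneg_right
            (by exact_mod_cast Set.ncard_le_ncard Set.inter_subset_left (Set.toFinite _)) hb0
  have h2 : ((A ∩ I).ncard : ℝ) ≤ (avoiding F A L ∩ I).ncard +
      (⋃ d ∈ (L ∩ A).toFinset, {z | F.Reachable d z}).ncard := by
    exact_mod_cast (Set.ncard_le_ncard hsub (Set.toFinite _)).trans (Set.ncard_union_le _ _)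
  linarith

/-! ### Rotations steered by expansion into a target set -/

/-- All sets of size less than `μ` avoiding `Y` expand into `W` outside the neighbourhood of `Y`. -/
def ExpandsInto {V : Type*} (G : SimpleGraph V) (μ : ℝ) (W Y : Set V) : Prop :=
  ∀ X : Set V, Disjoint X Y → (X.ncard : ℝ) < μ →
    10 ^ 6 * X.ncard ≤ ((nbhd G X ∩ W) \ nbhd G Y).ncard

/-- For nonempty `X`, removing `E` costs at most `2 ≤ 2|X|`, and `10 ^ 6 - 2` still exceeds `3 *
300000`. -/
theorem ExpandsInto.le_ncard {V : Type*} [Finite V] {G : SimpleGraph V} {μ : ℝ} {W Y E X : Set V}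
    (h : ExpandsInto G μ W Y) (hE : E.ncard ≤ 2) (hX : X ⊆ Yᶜ) (hXμ : (X.ncard : ℝ) < μ) :
    3 * 300000 * X.ncard ≤ (nbhd G X ∩ ((W \ nbhd G Y) \ E)).ncard := by
  rcases X.eq_empty_or_nonempty with rfl | hne
  · simp
  have h1 := h X (Set.disjoint_left.2 fun a ha => hX ha) hXμ
  have hsub : (nbhd G X ∩ W) \ nbhd G Y ⊆ (nbhd G X ∩ ((W \ nbhd G Y) \ E)) ∪ E := by
    rintro a ⟨⟨h1, h2⟩, h3⟩
    by_cases h : a ∈ E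
    · exact Or.inr h
    · exact Or.inl ⟨h1, ⟨h2, h3⟩, h⟩
  have h2 := (Set.ncard_le_ncard hsub (Set.toFinite _)).trans (Set.ncard_union_le _ _)
  have h3 : 0 < X.ncard := (Set.ncard_pos).2 hne
  omega

theorem exists_adj_of_deg_pos {V : Type*} {H : SimpleGraph V} {v : V} (h : 0 < deg H v) :
    ∃ w, H.Adj v w :=
  Set.nonempty_of_ncard_ne_zero h.ne'

/-- Logarithmically many rotations at vertices of `W` lead to an end outside a small set `Y'`. -/
theorem exists_rotates_notMem {V : Type*} [Finite V] {G H : SimpleGraph V} {μ : ℝ}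
    {W Y Y' E : Set V} {s₀ : V} {k : ℕ} (hac : H.IsAcyclic) (hle : H ≤ G)
    (hdeg : ∀ v, deg H v ≤ 2) (hE : E.ncard ≤ 2) (hE' : ∀ v, v ∉ E → 1 ≤ deg H v)
    (hexp : ExpandsInto G μ W Y) (hs₀ : s₀ ∉ Y) (hY' : (Y'.ncard : ℝ) < μ)
    (hk : μ ≤ (300000 : ℝ) ^ k) :
    ∃ j ≤ k, ∃ H' s', Rotates G H ((W \ nbhd G Y) \ E) ∅ s₀ j H' s' ∧ s' ∉ Y' := by
  have h := le_ncard_rotationEnds (G := G) (U := (W \ nbhd G Y) \ E) (root := ∅) (P := Yᶜ)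
    (s₀ := s₀) (k := k) (g := 300000) (μ := μ) hac Set.subsingleton_empty hdeg (by simp)
    (fun v hv => exists_adj_of_deg_pos (hE' v hv.2))
    (by simp) hs₀ (fun v hv w hvw hw => hv.1.2 ⟨w, hw, hle hvw.symm⟩)
    (fun X hX hXμ => hexp.le_ncard hE hX hXμ) (by exact_mod_cast hk)
  obtain ⟨s, ⟨j, hj, H', hH'⟩, hs⟩ := Set.exists_mem_notMem_of_ncard_lt_ncard
    (s := Y') (t := rotationEnds G H ((W \ nbhd G Y) \ E) ∅ s₀ k)
    (by exact_mod_cast hY'.trans_le h)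
  exact ⟨j, hj, H', s, hH', hs⟩

theorem ncard_symmDiff_deleteEdges_le {V : Type*} [Finite V] (H : SimpleGraph V) (e : Sym2 V) :
    (symmDiff H.edgeSet (H.deleteEdges {e}).edgeSet).ncard ≤ 1 := by
  refine (Set.ncard_le_ncard (t := {e}) ?_ (Set.toFinite _)).trans (by simp)
  intro e'
  rw [SimpleGraph.edgeSet_deleteEdges]
  simp only [Set.mem_symmDiff, Set.mem_sdiff, Set.mem_singleton_iff]
  tauto

open Classical in
/-- From an end `x` outside `A` that expands into `A`, the union `A` of components can be rearranged
so that one of many vertices `s` of `A` becomes an end, in a component other than that of the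
vertex `v₀` to which `x` will be attached. -/
theorem exists_rearrangement {V : Type*} [Finite V] {G H : SimpleGraph V} {μ : ℝ}
    {A W Y : Set V} {x : V} {k : ℕ} (hac : H.IsAcyclic) (hle : H ≤ G)
    (hdeg : ∀ v, deg H v ≤ 2) (hA : ClosedUnder H A) (hWA : W ⊆ A) (hW : ∀ v ∈ W, deg H v = 2)
    (hexp : ExpandsInto G μ W Y) (hx : x ∉ Y) (hμ : 1 < μ) (hk : μ ≤ (300000 : ℝ) ^ k) :
    ∃ v₀ ∈ A, G.Adj x v₀ ∧ ∃ S ⊆ A, μ ≤ S.ncard ∧ ∀ s ∈ S, ∃ J : SimpleGraph V,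
      J ≤ G ∧ J.IsAcyclic ∧ (∀ a, a ∉ A → ∀ b, J.Adj a b ↔ H.Adj a b) ∧ ¬ J.Reachable s v₀ ∧
      (∀ z, deg J z + (if z = v₀ then 1 else 0) + (if z = s then 1 else 0) = deg H z) ∧
      (symmDiff H.edgeSet J.edgeSet).ncard ≤ 2 * k + 1 := by
  -- Choosing `v₀` outside `nbhd G Y` forces its neighbour `w₀`, the first loose end, to lie outside
  -- `Y`.
  obtain ⟨v₀, ⟨⟨x', hx', hxv⟩, hv₀W⟩, hv₀Y⟩ : ((nbhd G {x} ∩ W) \ nbhd G Y).Nonempty := by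
    refine Set.nonempty_of_ncard_ne_zero ?_
    have := hexp {x} (Set.disjoint_singleton_left.2 hx) (by simpa using hμ)
    rw [Set.ncard_singleton] at this
    omega
  obtain rfl : x' = x := hx'
  obtain ⟨w₀, hvw⟩ := exists_adj_of_deg_pos (by rw [hW v₀ hv₀W]; norm_num)
  have hv₀A := hWA hv₀W
  have hw₀A : w₀ ∈ A := hA _ _ hvw hv₀A
  set H₀ := H.deleteEdges {s(v₀, w₀)} with hH₀
  have hH₀H : H₀ ≤ H := SimpleGraph.deleteEdges_le _
  have hd : ∀ z, deg H₀ z + (if z = v₀ then 1 else 0) + (if z = w₀ then 1 else 0) = deg H z :=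
    deg_deleteEdges hvw
  set U := (W \ nbhd G Y) \ {v₀, w₀} with hU
  have hUdeg : ∀ v ∈ U, deg H₀ v = 2 := by
    rintro v ⟨⟨hv, _⟩, hv'⟩
    simp only [Set.mem_insert_iff, Set.mem_singleton_iff, not_or] at hv'
    have h1 := hd v
    have h2 := hW v hv
    simp only [hv'.1, hv'.2, if_false, add_zero] at h1
    rw [← h2, ← h1]
  have hroot : ∀ r ∈ ({v₀} : Set V), ¬ H₀.Reachable w₀ r := by
    rintro r rfl h
    exact hac.not_reachable_deleteEdges hvw h.symm
  -- The root `v₀` keeps the rotated end out of the component to which `x` will be attached.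
  have hbig := le_ncard_rotationEnds (G := G) (H₀ := H₀) (U := U) (root := {v₀}) (P := Yᶜ)
    (s₀ := w₀) (k := k) (g := 300000) (μ := μ) (hac.anti hH₀H) Set.subsingleton_singleton
    (fun v => by have := hd v; have := hdeg v; omega) hroot
    (fun v hv => exists_adj_of_deg_pos (by rw [hUdeg v hv]; norm_num))
    (by
      rintro v hv r rfl
      refine ⟨fun h => hv.2 (Or.inl h), ?_⟩
      obtain ⟨a, b, hab, h⟩ := Set.ncard_eq_two.1 (hUdeg v hv)
      have ha : a ∈ H₀.neighborSet v := by rw [h]; simp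
      have hb : b ∈ H₀.neighborSet v := by rw [h]; simp
      exact ⟨a, b, hab, ha, hb⟩)
    (fun h => hv₀Y ⟨w₀, h, hle hvw.symm⟩)
    (fun v hv w hvw hw => hv.1.2 ⟨w, hw, hle (hH₀H hvw.symm)⟩)
    (fun X hX hXμ => hexp.le_ncard ((Set.ncard_insert_le _ _).trans (by simp)) hX hXμ)
    (by exact_mod_cast hk)
  have hUA : U ⊆ A := fun v hv => hWA hv.1.1
  have hA₀ : ClosedUnder H₀ A := fun a b hab => hA a b (hH₀H hab)
  refine ⟨v₀, hv₀A, hxv, _, ?_, hbig, ?_⟩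
  · rintro s ⟨j, _, J, hJ⟩
    exact hJ.mem_of_step hw₀A fun v hv w hvw => hA₀ v w hvw (hUA hv)
  rintro s ⟨j, hj, J, hJ⟩
  refine ⟨J, hJ.le (hH₀H.trans hle), hJ.isAcyclic (hac.anti hH₀H), fun a ha b => ?_,
    hJ.not_reachable hroot v₀ rfl, fun z => ?_, ?_⟩
  · rw [hJ.adj_iff_of_notMem hw₀A hUA hA₀ a ha b, hH₀, SimpleGraph.deleteEdges_adj]
    simp only [Set.mem_singleton_iff, Sym2.eq_iff]
    grind
  · have h1 := hJ.deg_eq z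
    have h2 := hd z
    omega
  · refine (ncard_symmDiff_trans _ H₀.edgeSet _).trans ?_
    have h1 : (symmDiff H.edgeSet H₀.edgeSet).ncard ≤ 1 := ncard_symmDiff_deleteEdges_le H _
    have h2 := hJ.ncard_symmDiff_le
    omega

/-! ### Patching and joining -/

/-- Replace `H` by `J` on the vertex set `A`. -/
def patch {V : Type*} (A : Set V) (J H : SimpleGraph V) : SimpleGraph V where
  Adj a b := (a ∈ A ∧ b ∈ A ∧ J.Adj a b) ∨ (a ∉ A ∧ b ∉ A ∧ H.Adj a b)
  symm := ⟨fun _ _ h => h.imp (fun h => ⟨h.2.1, h.1, h.2.2.symm⟩) fun h => ⟨h.2.1, h.1, h.2.2.symm⟩⟩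
  loopless := ⟨fun _ h => h.elim (fun h => h.2.2.ne rfl) fun h => h.2.2.ne rfl⟩

section patch

variable {V : Type*} {A : Set V} {J H : SimpleGraph V}

theorem patch_adj_of_mem (hJ : ClosedUnder J A) {a : V} (ha : a ∈ A) (b : V) :
    (patch A J H).Adj a b ↔ J.Adj a b := by
  have := hJ a b
  simp only [patch]
  tauto

theorem patch_adj_of_notMem (hH : ClosedUnder H A) {a : V} (ha : a ∉ A) (b : V) :
    (patch A J H).Adj a b ↔ H.Adj a b := by
  have := hH.compl a b
  simp only [patch, Set.mem_compl_iff] at *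
  tauto

theorem patch_closedUnder : ClosedUnder (patch A J H) A := by
  intro a b hab ha
  simp only [patch] at hab
  tauto

theorem patch_isAcyclic (hJ : J.IsAcyclic) (hH : H.IsAcyclic) : (patch A J H).IsAcyclic := by
  refine SimpleGraph.isAcyclic_of_closed hJ hH (T := A) ?_ ?_ <;>
  · intro a b hab ha
    simp only [patch] at hab
    tauto

theorem patch_le {G : SimpleGraph V} (hJ : J ≤ G) (hH : H ≤ G) : patch A J H ≤ G :=
  fun _ _ hab => hab.elim (fun h => hJ h.2.2) fun h => hH h.2.2

theorem closedUnder_of_agree (hH : ClosedUnder H A) (h : ∀ a, a ∉ A → ∀ b, J.Adj a b ↔ H.Adj a b) :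
    ClosedUnder J A := by
  intro a b hab ha
  by_contra hb
  exact hb (hH a b ((h b hb a).1 hab.symm).symm ha)

theorem edgeSet_patch_symmDiff (hH : ClosedUnder H A) (hJ : ClosedUnder J A) :
    symmDiff H.edgeSet (patch A J H).edgeSet ⊆ symmDiff H.edgeSet J.edgeSet := by
  intro e
  induction e using Sym2.ind with
  | _ a b =>
    by_cases ha : a ∈ A
    · simp only [Set.mem_symmDiff, SimpleGraph.mem_edgeSet, patch_adj_of_mem hJ ha, imp_self]
    · simp only [Set.mem_symmDiff, SimpleGraph.mem_edgeSet, patch_adj_of_notMem hH ha]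
      tauto

theorem deg_congr {z : V} (h : ∀ b, J.Adj z b ↔ H.Adj z b) : deg J z = deg H z := by
  unfold deg
  congr 1
  ext b
  exact h b

end patch

theorem ncard_symmDiff_sup_edge_le {V : Type*} [Finite V] (H : SimpleGraph V) (a b : V) :
    (symmDiff H.edgeSet (H ⊔ SimpleGraph.edge a b).edgeSet).ncard ≤ 1 := by
  refine (Set.ncard_le_ncard (t := {s(a, b)}) ?_ (Set.toFinite _)).trans (by simp)
  intro e
  induction e using Sym2.ind with
  | _ c d =>
    simp only [Set.mem_symmDiff, SimpleGraph.mem_edgeSet, SimpleGraph.sup_adj,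
      SimpleGraph.edge_adj, Set.mem_singleton_iff, Sym2.eq_iff]
    tauto

theorem sup_edge_le {V : Type*} {G H : SimpleGraph V} {a b : V} (h : H ≤ G) (hab : G.Adj a b) :
    H ⊔ SimpleGraph.edge a b ≤ G :=
  sup_le h ((SimpleGraph.edge_le_iff _).2 (Or.inr hab))

open Classical in
theorem deg_sup_edge_of_not_reachable {V : Type*} [Finite V] {H : SimpleGraph V} {a b : V}
    (h : ¬ H.Reachable a b) (z : V) :
    deg (H ⊔ SimpleGraph.edge a b) z =
      deg H z + (if z = a then 1 else 0) + (if z = b then 1 else 0) :=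
  deg_sup_edge (by rintro rfl; exact h (SimpleGraph.Reachable.refl a)) (fun hab => h hab.reachable) z

theorem ClosedUnder.sup_edge {V : Type*} {H : SimpleGraph V} {T : Set V} {a b : V}
    (hT : ClosedUnder H T) (ha : a ∉ T) (hb : b ∉ T) :
    ClosedUnder (H ⊔ SimpleGraph.edge a b) T := by
  intro c d hcd hc
  rw [SimpleGraph.sup_adj, SimpleGraph.edge_adj] at hcd
  rcases hcd with h | ⟨⟨rfl, rfl⟩ | ⟨rfl, rfl⟩, _⟩
  · exact hT _ _ h hc
  · exact absurd hc ha
  · exact absurd hc hb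

open Classical in
/-- Join two ends `x` and `y` through rearranged parts `A` and `B` of the forest. -/
theorem exists_join {V : Type*} [Finite V] {G H J J' : SimpleGraph V} {A B : Set V}
    {x y v v' s t : V} {m : ℕ} (hac : H.IsAcyclic) (hle : H ≤ G) (hA : ClosedUnder H A)
    (hB : ClosedUnder H B) (hAB : Disjoint A B) (hxA : x ∉ A) (hxB : x ∉ B) (hyA : y ∉ A)
    (hyB : y ∉ B) (hvA : v ∈ A) (hvB : v' ∈ B) (hxv : G.Adj x v) (hyv : G.Adj y v')
    (hs : s ∈ A) (ht : t ∈ B) (hst : G.Adj s t)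
    (hJle : J ≤ G) (hJac : J.IsAcyclic) (hJ : ∀ a, a ∉ A → ∀ b, J.Adj a b ↔ H.Adj a b)
    (hJr : ¬ J.Reachable s v)
    (hJd : ∀ z, deg J z + (if z = v then 1 else 0) + (if z = s then 1 else 0) = deg H z)
    (hJm : (symmDiff H.edgeSet J.edgeSet).ncard ≤ m)
    (hJle' : J' ≤ G) (hJac' : J'.IsAcyclic) (hJ' : ∀ a, a ∉ B → ∀ b, J'.Adj a b ↔ H.Adj a b)
    (hJd' : ∀ z, deg J' z + (if z = v' then 1 else 0) + (if z = t then 1 else 0) = deg H z)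
    (hJm' : (symmDiff H.edgeSet J'.edgeSet).ncard ≤ m) :
    ∃ F' : SimpleGraph V, F' ≤ G ∧ F'.IsAcyclic ∧
      (∀ z, deg F' z = deg H z + (if z = x then 1 else 0) + (if z = y then 1 else 0)) ∧
      (symmDiff H.edgeSet F'.edgeSet).ncard ≤ 2 * m + 3 := by
  have hJA := closedUnder_of_agree hA hJ
  have hJB := closedUnder_of_agree hB hJ'
  have hAB' : ∀ {a}, a ∈ A → a ∉ B := fun ha hb => Set.disjoint_left.1 hAB ha hb
  have hBA' : ∀ {a}, a ∈ B → a ∉ A := fun hb ha => Set.disjoint_left.1 hAB ha hb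
  set H₁ := patch A J H with hH₁
  have hH₁B : ClosedUnder H₁ B := by
    intro a b hab ha
    exact hB a b ((patch_adj_of_notMem hA (hBA' ha) b).1 hab) ha
  set H₂ := patch B J' H₁ with hH₂
  have hadjA : ∀ a ∈ A, ∀ b, H₂.Adj a b ↔ J.Adj a b := fun a ha b => by
    rw [hH₂, patch_adj_of_notMem hH₁B (hAB' ha), hH₁, patch_adj_of_mem hJA ha]
  have hadjB : ∀ a ∈ B, ∀ b, H₂.Adj a b ↔ J'.Adj a b := fun a ha b => by
    rw [hH₂, patch_adj_of_mem hJB ha]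
  have hadj : ∀ a, a ∉ A → a ∉ B → ∀ b, H₂.Adj a b ↔ H.Adj a b := fun a ha ha' b => by
    rw [hH₂, patch_adj_of_notMem hH₁B ha', hH₁, patch_adj_of_notMem hA ha]
  have hA₂ : ClosedUnder H₂ A := fun a b hab ha => hJA a b ((hadjA a ha b).1 hab) ha
  have hB₂ : ClosedUnder H₂ B := patch_closedUnder
  have hdeg₂ : ∀ z, deg H₂ z + (if z = v then 1 else 0) + (if z = s then 1 else 0) +
      (if z = v' then 1 else 0) + (if z = t then 1 else 0) = deg H z := by
    intro z
    by_cases hz : z ∈ A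
    · have h1 : z ≠ v' := by rintro rfl; exact hAB' hz hvB
      have h2 : z ≠ t := by rintro rfl; exact hAB' hz ht
      rw [deg_congr (hadjA z hz), hJd, if_neg h1, if_neg h2, add_zero, add_zero]
    · have h1 : z ≠ v := by rintro rfl; exact hz hvA
      have h2 : z ≠ s := by rintro rfl; exact hz hs
      rw [if_neg h1, if_neg h2, add_zero, add_zero]
      by_cases hz' : z ∈ B
      · rw [deg_congr (hadjB z hz'), hJd']
      · have h3 : z ≠ v' := by rintro rfl; exact hz' hvB
        have h4 : z ≠ t := by rintro rfl; exact hz' ht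
        rw [if_neg h3, if_neg h4, add_zero, add_zero, deg_congr (hadj z hz hz')]
  have hr₁ : ¬ H₂.Reachable x v := SimpleGraph.not_reachable_of_closed hA₂.compl hxA (· hvA)
  set H₃ := H₂ ⊔ SimpleGraph.edge x v with hH₃
  have hr₂ : ¬ H₃.Reachable y v' := SimpleGraph.not_reachable_of_closed
    (hB₂.sup_edge hxB (hAB' hvA)).compl hyB (· hvB)
  set H₄ := H₃ ⊔ SimpleGraph.edge y v' with hH₄
  -- The component of `s` lies in `A` and misses `v`, so the edges `xv` and `yv'` do not touch it.
  -- Separation on the `A` side alone therefore suffices.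
  have hr₃ : ¬ H₄.Reachable s t := by
    set T := {z | H₂.Reachable s z} with hT
    have hTA : T ⊆ A := fun z hz => hA₂.mem_of_reachable hz hs
    have hvT : v ∉ T := by
      refine SimpleGraph.not_reachable_of_closed (T := {z | J.Reachable s z}) ?_
        (SimpleGraph.Reachable.refl s) hJr
      intro a b hab ha
      exact SimpleGraph.Reachable.trans ha
        ((hadjA a (hJA.mem_of_reachable ha hs) b).1 hab).reachable
    exact SimpleGraph.not_reachable_of_closed
      (((closedUnder_reachable H₂ s).sup_edge (fun h => hxA (hTA h)) hvT).sup_edge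
        (fun h => hyA (hTA h)) fun h => hBA' hvB (hTA h))
      (SimpleGraph.Reachable.refl s) fun h => hBA' ht (hTA h)
  refine ⟨H₄ ⊔ SimpleGraph.edge s t, ?_, ?_, fun z => ?_, ?_⟩
  · exact sup_edge_le (sup_edge_le (sup_edge_le (patch_le hJle' (patch_le hJle hle)) hxv) hyv) hst
  · exact (((patch_isAcyclic hJac' (patch_isAcyclic hJac hac)).sup_edge_of_not_reachable
      hr₁).sup_edge_of_not_reachable hr₂).sup_edge_of_not_reachable hr₃
  · rw [deg_sup_edge_of_not_reachable hr₃, hH₄, deg_sup_edge_of_not_reachable hr₂, hH₃,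
      deg_sup_edge_of_not_reachable hr₁, ← hdeg₂ z]
    ring
  · have h₁ : (symmDiff H.edgeSet H₁.edgeSet).ncard ≤ m :=
      (Set.ncard_le_ncard (edgeSet_patch_symmDiff hA hJA) (Set.toFinite _)).trans hJm
    have h₂ : (symmDiff H₁.edgeSet H₂.edgeSet).ncard ≤ m := by
      refine (Set.ncard_le_ncard ?_ (Set.toFinite _)).trans hJm'
      intro e
      induction e using Sym2.ind with
      | _ a b =>
        simp only [Set.mem_symmDiff, SimpleGraph.mem_edgeSet]
        by_cases ha : a ∈ B
        · rw [hadjB a ha, hH₁, patch_adj_of_notMem hA (hBA' ha)]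
          exact id
        · rw [hH₂, patch_adj_of_notMem hH₁B ha]
          tauto
    have h₃ : (symmDiff H₂.edgeSet H₃.edgeSet).ncard ≤ 1 := ncard_symmDiff_sup_edge_le H₂ x v
    have h₄ : (symmDiff H₃.edgeSet H₄.edgeSet).ncard ≤ 1 := ncard_symmDiff_sup_edge_le H₃ y v'
    have h₅ := ncard_symmDiff_sup_edge_le H₄ s t
    have t₁ := ncard_symmDiff_trans H.edgeSet H₁.edgeSet H₂.edgeSet
    have t₂ := ncard_symmDiff_trans H.edgeSet H₂.edgeSet H₃.edgeSet
    have t₃ := ncard_symmDiff_trans H.edgeSet H₃.edgeSet H₄.edgeSet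
    have t₄ := ncard_symmDiff_trans H.edgeSet H₄.edgeSet (H₄ ⊔ SimpleGraph.edge s t).edgeSet
    omega

/-! ### Endpoints from degrees, and the complete case -/

theorem NoIsolatedVertices.one_le_deg {V : Type*} [Finite V] {F : SimpleGraph V}
    (hF : NoIsolatedVertices F) (v : V) : 1 ≤ deg F v :=
  Nat.one_le_iff_ne_zero.2 fun h => hF v (F.neighborSet_eq_empty.1 ((Set.ncard_eq_zero).1 h))

open Classical in
/-- If `F'` is acyclic and `x`, `y` are the only vertices gaining a neighbour, then passing to `F'`
removes exactly the endpoints `x` and `y`. -/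
theorem linearForest_of_deg_eq {V : Type*} [Fintype V] {G F F' : SimpleGraph V} {x y : V}
    (hF : IsSpanningLinearForest G F) (hiso : NoIsolatedVertices F) (hx : x ∈ endpoints F)
    (hy : y ∈ endpoints F) (hxy : x ≠ y) (hle : F' ≤ G) (hac : F'.IsAcyclic)
    (hdeg : ∀ z, deg F' z = deg F z + (if z = x then 1 else 0) + (if z = y then 1 else 0)) :
    IsSpanningLinearForest G F' ∧ NoIsolatedVertices F' ∧
      endpoints F' = endpoints F \ {x, y} := by
  have h1 : ∀ z, 1 ≤ deg F z := hiso.one_le_deg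
  have h2 : ∀ z, deg F z ≤ 2 := hF.2.2
  have hx' : deg F x ≤ 1 := hx
  have hy' : deg F y ≤ 1 := hy
  refine ⟨⟨hle, hac, fun z => ?_⟩, fun z hz => ?_, ?_⟩
  · change deg F' z ≤ 2
    have := h2 z
    rw [hdeg]
    grind
  · have h : deg F' z = 0 := by
      rw [deg, F'.neighborSet_eq_empty.2 hz, Set.ncard_empty]
    have := h1 z
    have := hdeg z
    omega
  · ext z
    change deg F' z ≤ 1 ↔ deg F z ≤ 1 ∧ ¬ (z = x ∨ z = y)
    have := h1 z
    rw [hdeg]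
    grind

-- The edge `zw` of a path containing neither `x` nor `y` is replaced by the edges `xz` and `wy`.
-- The piece containing `w` is untouched by `xz`, so no cycle arises.
open Classical in
theorem exists_forest_of_complete {V : Type*} [Finite V] {G F : SimpleGraph V} {x y z w : V}
    (hG : ∀ a b, a ≠ b → G.Adj a b) (hac : F.IsAcyclic) (hzw : F.Adj z w)
    (hxz : ¬ F.Reachable z x) (hyz : ¬ F.Reachable z y) :
    ∃ F' : SimpleGraph V, F' ≤ G ∧ F'.IsAcyclic ∧
      (∀ v, deg F' v = deg F v + (if v = x then 1 else 0) + (if v = y then 1 else 0)) ∧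
      (symmDiff F.edgeSet F'.edgeSet).ncard ≤ 3 := by
  set F₁ := F.deleteEdges {s(z, w)} with hF₁
  have hle : F₁ ≤ F := SimpleGraph.deleteEdges_le _
  have hr₁ : ¬ F₁.Reachable x z := fun h => hxz (h.mono hle).symm
  set F₂ := F₁ ⊔ SimpleGraph.edge x z with hF₂
  have hT : ∀ a, F₁.Reachable w a → F.Reachable z a := fun a h =>
    hzw.reachable.trans (h.mono hle)
  have hr₂ : ¬ F₂.Reachable w y := SimpleGraph.not_reachable_of_closed
    ((closedUnder_reachable F₁ w).sup_edge (fun h => hxz (hT _ h))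
      fun h => hac.not_reachable_deleteEdges hzw (SimpleGraph.Reachable.symm h))
    (SimpleGraph.Reachable.refl w) fun h => hyz (hT _ h)
  have hle' : ∀ H : SimpleGraph V, H ≤ G := fun H a b hab => hG a b hab.ne
  refine ⟨F₂ ⊔ SimpleGraph.edge w y, hle' _, ((hac.anti hle).sup_edge_of_not_reachable
    hr₁).sup_edge_of_not_reachable hr₂, fun v => ?_, ?_⟩
  · rw [deg_sup_edge_of_not_reachable hr₂, hF₂, deg_sup_edge_of_not_reachable hr₁,
      ← deg_deleteEdges hzw v]
    ring
  · have h₁ : (symmDiff F.edgeSet F₁.edgeSet).ncard ≤ 1 := by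
      rw [hF₁]; exact ncard_symmDiff_deleteEdges_le F _
    have h₂ : (symmDiff F₁.edgeSet F₂.edgeSet).ncard ≤ 1 := ncard_symmDiff_sup_edge_le F₁ x z
    have h₃ := ncard_symmDiff_sup_edge_le F₂ w y
    have t₁ := ncard_symmDiff_trans F.edgeSet F₁.edgeSet F₂.edgeSet
    have t₂ := ncard_symmDiff_trans F.edgeSet F₂.edgeSet (F₂ ⊔ SimpleGraph.edge w y).edgeSet
    omega

/-! ### Parameters and the choice of `A` and `B` -/

theorem rotation_count_bounds {n : ℝ} (hn : 2 * 10 ^ 10 < n) {k : ℕ} (hk : k = ⌈Real.log n⌉₊) :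
    (6 * k + 2) * (√n + 1) ≤ n / 250 ∧ 1 ≤ Real.log n ∧ (k : ℝ) ≤ 2 * Real.log n ∧
      n ≤ (300000 : ℝ) ^ k := by
  have hn0 : 0 < n := by linarith
  have hlog1 : 1 ≤ Real.log n := by
    rw [Real.le_log_iff_exp_le hn0]
    linarith [Real.exp_one_lt_three]
  have hk1 : (k : ℝ) ≤ Real.log n + 1 := by
    rw [hk]
    exact (Nat.ceil_lt_add_one (by linarith)).le
  have hk2 : Real.log n ≤ k := by
    rw [hk]
    exact Nat.le_ceil _
  refine ⟨?_, hlog1, by linarith, ?_⟩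
  · set t := √n with ht
    have ht2 : t * t = n := Real.mul_self_sqrt hn0.le
    have ht1 : 140000 ≤ t := by
      rw [ht]
      exact Real.le_sqrt_of_sq_le (by linarith)
    have ht0 : 0 < t := by linarith
    have hlogt : Real.log n = 2 * Real.log t := by
      rw [← ht2, Real.log_mul ht0.ne' ht0.ne']
      ring
    -- Rescaling by `2 ^ 17`, close to the lower bound for `t`, makes `log u ≤ u - 1` sharp enough.
    have h1 := Real.log_le_sub_one_of_pos (show 0 < t / 2 ^ 17 by positivity)
    rw [Real.log_div ht0.ne' (by positivity), Real.log_pow] at h1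
    have h2 := Real.log_two_lt_d9
    push_cast at h1
    have h3 : Real.log t ≤ t / 131072 + 11 := by linarith
    have h4 : 6 * (k : ℝ) + 2 ≤ 12 * (t / 131072 + 11) + 8 := by linarith
    nlinarith
  · calc n = Real.exp (Real.log n) := (Real.exp_log hn0).symm
      _ ≤ Real.exp k := Real.exp_le_exp.2 hk2
      _ = Real.exp 1 ^ k := by rw [← Real.exp_nat_mul, mul_one]
      _ ≤ (300000 : ℝ) ^ k := pow_le_pow_left₀ (Real.exp_pos 1).le
          (by linarith [Real.exp_one_lt_three]) k

theorem IsExpander.expandsInto_univ {V : Type*} [Fintype V] {C : ℝ} {G : SimpleGraph V}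
    (hC : 10 ^ 10 < C) (hG : IsExpander C G) :
    ExpandsInto G ((Fintype.card V : ℝ) / (2 * C)) Set.univ ∅ := by
  intro X _ hX
  have h1 := hG.expands X hX
  have h2 : outerNbhd G X ⊆ (nbhd G X ∩ Set.univ) \ nbhd G ∅ := fun v hv =>
    ⟨⟨hv.2, trivial⟩, fun ⟨u, hu, _⟩ => hu⟩
  have h3 : ((outerNbhd G X).ncard : ℝ) ≤ ((nbhd G X ∩ Set.univ) \ nbhd G ∅).ncard := by
    exact_mod_cast Set.ncard_le_ncard h2 (Set.toFinite _)
  have h4 : (0 : ℝ) ≤ X.ncard := Nat.cast_nonneg _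
  have h5 : (10 : ℝ) ^ 6 * X.ncard ≤ ((nbhd G X ∩ Set.univ) \ nbhd G ∅).ncard := by nlinarith
  exact_mod_cast h5

theorem ClosedUnder.congr {V : Type*} {F H : SimpleGraph V} {T : Set V} (hT : ClosedUnder F T)
    (h : ∀ a ∈ T, ∀ b, H.Adj a b ↔ F.Adj a b) : ClosedUnder H T :=
  fun a b hab ha => hT a b ((h a ha b).1 hab) ha

/-- Two disjoint unions of paths of medium length, each with many inner vertices, such that many
vertices lie outside both. -/
theorem exists_two_parts {V : Type*} [Fintype V] {F : SimpleGraph V} {M : Set V} {b : ℝ}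
    (hM : ClosedUnder F M) (hlen : ∀ v ∈ M, 2 ≤ pathLength F v)
    (hlen' : ∀ v ∈ M, (pathLength F v : ℝ) + 1 ≤ b) (h1 : ∀ v, 1 ≤ deg F v)
    (h2 : ∀ v, deg F v ≤ 2) (hMn : 1 / 10 * (Fintype.card V : ℝ) ≤ M.ncard)
    (hb0 : 0 ≤ b) (hb : b ≤ (Fintype.card V : ℝ) / 200) :
    ∃ A B : Set V, A ⊆ M ∧ B ⊆ M ∧ ClosedUnder F A ∧ ClosedUnder F B ∧ Disjoint A B ∧
      (Fintype.card V : ℝ) / 200 ≤ (A ∩ {v | deg F v = 2}).ncard ∧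
      (Fintype.card V : ℝ) / 200 ≤ (B ∩ {v | deg F v = 2}).ncard ∧
      (Fintype.card V : ℝ) / 1000 ≤ (A ∪ B)ᶜ.ncard := by
  set n : ℝ := (Fintype.card V : ℝ) with hn
  set I : Set V := {v | deg F v = 2}
  have hn0 : 0 ≤ n := Nat.cast_nonneg _
  have hcomp : ∀ v ∈ M, ({z | F.Reachable v z}.ncard : ℝ) ≤ b := fun v hv =>
    le_trans (by exact_mod_cast ncard_reachable_le F v) (hlen' v hv)
  have hMI : (M.ncard : ℝ) ≤ 3 * (M ∩ I).ncard := by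
    exact_mod_cast ncard_le_three_mul_inner hM hlen h1 h2
  -- There are at least `n/30` inner vertices in `M`. Each of `A` and `B` takes at most `n/200 + b ≤
  -- n/100` of them, so at least `n/75` remain.
  obtain ⟨A, hAM, hA, hA1, hA2⟩ := exists_closedUnder_subset (I := I) (t := n / 200) hM hcomp hb0
    (by positivity) (by linarith)
  have hsplit : ∀ S T : Set V, ((S ∩ I).ncard : ℝ) ≤ (T ∩ I).ncard + ((S \ T) ∩ I).ncard := by
    intro S T
    have hsub : S ∩ I ⊆ (T ∩ I) ∪ ((S \ T) ∩ I) := by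
      rintro v ⟨h, h'⟩
      by_cases hv : v ∈ T
      · exact Or.inl ⟨hv, h'⟩
      · exact Or.inr ⟨⟨h, hv⟩, h'⟩
    exact_mod_cast (Set.ncard_le_ncard hsub (Set.toFinite _)).trans (Set.ncard_union_le _ _)
  have hMA := hsplit M A
  obtain ⟨B, hBM, hB, hB1, hB2⟩ := exists_closedUnder_subset (I := I) (t := n / 200) (hM.diff hA)
    (fun v hv => hcomp v hv.1) hb0 (by positivity) (by linarith)
  refine ⟨A, B, hAM, hBM.trans Set.sdiff_subset, hA, hB,
    Set.disjoint_left.2 fun a ha hb => (hBM hb).2 ha, hA1, hB1, ?_⟩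
  have hMB := hsplit (M \ A) B
  have hR : ((((M \ A) \ B) ∩ I).ncard : ℝ) ≤ (A ∪ B)ᶜ.ncard := by
    have hsub : ((M \ A) \ B) ∩ I ⊆ (A ∪ B)ᶜ := fun v hv h => h.elim hv.1.1.2 hv.1.2
    exact_mod_cast Set.ncard_le_ncard hsub (Set.toFinite _)
  linarith

/-! ### Assembly in a large expander -/

-- Each end is moved in two stages. Unrestricted rotations first bring both ends outside the
-- exceptional set of the region `R = (A₀ ∪ B₀)ᶜ`, at the cost of damaging some paths. Only then are
-- `A` and `B` formed from the undamaged paths and their exceptional sets `YA`, `YB` known;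
-- rotations at vertices of `R` avoid these while leaving `A` and `B` intact.
open Classical in
theorem exists_forest_of_expander {V : Type*} [Fintype V] {C : ℝ} {G F : SimpleGraph V} {x y : V}
    {A₀ B₀ : Set V} {b : ℝ} {k : ℕ} (hC : 10 ^ 10 < C) (hG : IsExpander C G)
    (hn : 2 * C < Fintype.card V) (hac : F.IsAcyclic) (hle : F ≤ G) (h1 : ∀ v, 1 ≤ deg F v)
    (h2 : ∀ v, deg F v + (if v = x then 1 else 0) + (if v = y then 1 else 0) ≤ 2)
    (hA₀ : ClosedUnder F A₀) (hB₀ : ClosedUnder F B₀) (hAB₀ : Disjoint A₀ B₀)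
    (hbA : ∀ v ∈ A₀, ({z | F.Reachable v z}.ncard : ℝ) ≤ b)
    (hbB : ∀ v ∈ B₀, ({z | F.Reachable v z}.ncard : ℝ) ≤ b) (hb0 : 0 ≤ b)
    (hA₀n : (Fintype.card V : ℝ) / 200 ≤ (A₀ ∩ {v | deg F v = 2}).ncard)
    (hB₀n : (Fintype.card V : ℝ) / 200 ≤ (B₀ ∩ {v | deg F v = 2}).ncard)
    (hRn : (Fintype.card V : ℝ) / 1000 ≤ (A₀ ∪ B₀)ᶜ.ncard)
    (hk : (Fintype.card V : ℝ) ≤ 300000 ^ k)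
    (hkb : (6 * k + 2) * b ≤ (Fintype.card V : ℝ) / 250) :
    ∃ F' : SimpleGraph V, F' ≤ G ∧ F'.IsAcyclic ∧
      (∀ z, deg F' z = deg F z + (if z = x then 1 else 0) + (if z = y then 1 else 0)) ∧
      (symmDiff F.edgeSet F'.edgeSet).ncard ≤ 12 * k + 5 := by
  set n : ℝ := (Fintype.card V : ℝ) with hn'
  set μ : ℝ := n / (2 * C) with hμ
  have hμ1 : 1 < μ := (one_lt_div (by linarith)).2 hn
  have hμn : μ ≤ n := div_le_self (Nat.cast_nonneg _) (by linarith)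
  have hkμ : μ ≤ 300000 ^ k := hμn.trans hk
  obtain ⟨YR, hYR, hYR'⟩ := exists_exceptional_set hC hG hRn
  have hexp := IsExpander.expandsInto_univ hC hG
  obtain ⟨j₁, hj₁, H₁, sx, hw₁, hsx⟩ := exists_rotates_notMem (s₀ := x) (E := ∅) (k := k) hac hle
    (fun v => by have := h2 v; omega) (by simp) (fun v _ => h1 v) hexp (by simp) hYR hkμ
  have hd₁ := hw₁.deg_eq
  have hac₁ := hw₁.isAcyclic hac
  have hle₁ := hw₁.le hle
  obtain ⟨j₂, hj₂, H₂, sy, hw₂, hsy⟩ := exists_rotates_notMem (s₀ := y) (E := {sx}) (k := k)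
    hac₁ hle₁ (fun v => by have := h2 v; have := hd₁ v; omega) (by simp)
    (fun v hv => by
      have := h1 v
      have := hd₁ v
      rw [if_neg (by simpa using hv)] at this
      omega) hexp (by simp) hYR hkμ
  have hd₂ := hw₂.deg_eq
  have hac₂ := hw₂.isAcyclic hac₁
  have hle₂ := hw₂.le hle₁
  obtain ⟨L₁, hL₁, hL₁'⟩ := hw₁.exists_touched
  obtain ⟨L₂, hL₂, hL₂'⟩ := hw₂.exists_touched
  -- The ends are added separately because an empty sequence of rotations touches nothing.
  set L : Set V := (L₁ ∪ L₂) ∪ {sx, sy} with hL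
  have hLn : (L.ncard : ℝ) ≤ 6 * k + 2 := by
    have t₁ := Set.ncard_union_le (L₁ ∪ L₂) {sx, sy}
    have t₂ := Set.ncard_union_le L₁ L₂
    have t₃ := Set.ncard_insert_le sx {sy}
    rw [Set.ncard_singleton] at t₃
    have : L.ncard ≤ 6 * k + 2 := by rw [hL]; omega
    exact_mod_cast this
  have hLb : (L.ncard : ℝ) * b ≤ n / 250 := (mul_le_mul_of_nonneg_right hLn hb0).trans hkb
  set A := avoiding F A₀ L with hAdef
  set B := avoiding F B₀ L with hBdef
  -- The loss is at most `n/250`, and `n/200 - n/250 = n/1000`.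
  have hAn : n / 1000 ≤ (A ∩ {v | deg F v = 2}).ncard := by
    have := ncard_le_ncard_avoiding (I := {v | deg F v = 2}) (L := L) hA₀ hbA hb0
    linarith
  have hBn : n / 1000 ≤ (B ∩ {v | deg F v = 2}).ncard := by
    have := ncard_le_ncard_avoiding (I := {v | deg F v = 2}) (L := L) hB₀ hbB hb0
    linarith
  have hAB : Disjoint A B := hAB₀.mono avoiding_subset avoiding_subset
  have hAF : ClosedUnder F A := closedUnder_avoiding hA₀ L
  have hBF : ClosedUnder F B := closedUnder_avoiding hB₀ L
  have hL' : ∀ a ∈ A ∪ B, a ∉ L := fun a ha =>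
    ha.elim notMem_of_mem_avoiding notMem_of_mem_avoiding
  have hadj₂ : ∀ a ∈ A ∪ B, ∀ c, H₂.Adj a c ↔ F.Adj a c := fun a ha c => by
    have h := hL' a ha
    simp only [hL, Set.mem_union, not_or] at h
    rw [hL₂' a h.1.2, hL₁' a h.1.1]
  set T : Set V := (A ∪ B)ᶜ with hT
  have hT₂ : ClosedUnder H₂ T := ((hAF.union hBF).congr hadj₂).compl
  have hsxT : sx ∈ T := fun h => hL' sx h (by simp [hL])
  have hsyT : sy ∈ T := fun h => hL' sy h (by simp [hL])
  have hRT : (A₀ ∪ B₀)ᶜ ⊆ T := Set.compl_subset_compl.2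
    (Set.union_subset_union avoiding_subset avoiding_subset)
  have hUT : ∀ E : Set V, ((A₀ ∪ B₀)ᶜ \ nbhd G YR) \ E ⊆ T := fun E v hv => hRT hv.1.1
  obtain ⟨YA, hYA, hYA'⟩ := exists_exceptional_set hC hG hAn
  obtain ⟨YB, hYB, hYB'⟩ := exists_exceptional_set hC hG hBn
  -- Only `sx` and `sy` may be isolated at this point, so they are excluded as rotation vertices.
  obtain ⟨j₃, hj₃, H₃, x₁, hw₃, hx₁⟩ := exists_rotates_notMem (s₀ := sx) (E := {sx, sy}) (k := k)
    hac₂ hle₂ (fun v => by have := h2 v; have := hd₁ v; have := hd₂ v; omega)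
    ((Set.ncard_insert_le _ _).trans (by simp))
    (fun v hv => by
      simp only [Set.mem_insert_iff, Set.mem_singleton_iff, not_or] at hv
      have := h1 v
      have e₁ := hd₁ v
      have e₂ := hd₂ v
      rw [if_neg hv.1] at e₁
      rw [if_neg hv.2] at e₂
      omega) hYR' hsx hYA hkμ
  have hd₃ := hw₃.deg_eq
  have hac₃ := hw₃.isAcyclic hac₂
  have hle₃ := hw₃.le hle₂
  have hx₁T : x₁ ∈ T := hw₃.mem_of_step hsxT fun v hv w hvw => hT₂ v w hvw (hUT _ hv)
  have hadj₃ : ∀ a ∈ A ∪ B, ∀ c, H₃.Adj a c ↔ F.Adj a c := fun a ha c => by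
    rw [hw₃.adj_iff_of_notMem hsxT (hUT _) hT₂ a (fun h => h ha), hadj₂ a ha]
  have hT₃ : ClosedUnder H₃ T := ((hAF.union hBF).congr hadj₃).compl
  obtain ⟨j₄, hj₄, H, y₁, hw₄, hy₁⟩ := exists_rotates_notMem (s₀ := sy) (E := {x₁, sy}) (k := k)
    hac₃ hle₃ (fun v => by
      have := h2 v; have := hd₁ v; have := hd₂ v; have := hd₃ v; omega)
    ((Set.ncard_insert_le _ _).trans (by simp))
    (fun v hv => by
      simp only [Set.mem_insert_iff, Set.mem_singleton_iff, not_or] at hv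
      have := h1 v
      have e₁ := hd₁ v
      have e₂ := hd₂ v
      have e₃ := hd₃ v
      rw [if_neg hv.1] at e₃
      rw [if_neg hv.2] at e₂
      omega) hYR' hsy hYB hkμ
  have hd₄ := hw₄.deg_eq
  have hacH := hw₄.isAcyclic hac₃
  have hleH := hw₄.le hle₃
  have hy₁T : y₁ ∈ T := hw₄.mem_of_step hsyT fun v hv w hvw => hT₃ v w hvw (hUT _ hv)
  have hadj : ∀ a ∈ A ∪ B, ∀ c, H.Adj a c ↔ F.Adj a c := fun a ha c => by
    rw [hw₄.adj_iff_of_notMem hsyT (hUT _) hT₃ a (fun h => h ha), hadj₃ a ha]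
  have hdH : ∀ z, deg H z + (if z = x₁ then 1 else 0) + (if z = y₁ then 1 else 0) =
      deg F z + (if z = x then 1 else 0) + (if z = y then 1 else 0) := fun z => by
    have := hd₁ z; have := hd₂ z; have := hd₃ z; have := hd₄ z; omega
  have hAH : ClosedUnder H A := hAF.congr fun a ha => hadj a (Or.inl ha)
  have hBH : ClosedUnder H B := hBF.congr fun a ha => hadj a (Or.inr ha)
  have hdeg : ∀ v, deg H v ≤ 2 := fun v => by have := h2 v; have := hdH v; omega
  obtain ⟨v, hvA, hxv, S, hSA, hS, hSJ⟩ := exists_rearrangement (k := k) hacH hleH hdeg hAH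
    Set.inter_subset_left (fun v hv => (deg_congr (hadj v (Or.inl hv.1))).trans hv.2) hYA' hx₁
    hμ1 hkμ
  obtain ⟨v', hvB, hyv, S', hSB, hS', hSJ'⟩ := exists_rearrangement (k := k) hacH hleH hdeg hBH
    Set.inter_subset_left (fun v hv => (deg_congr (hadj v (Or.inr hv.1))).trans hv.2) hYB' hy₁
    hμ1 hkμ
  obtain ⟨s, hs, t, ht, hst⟩ := hG.joined S S' (hAB.mono hSA hSB) hS hS'
  obtain ⟨J, hJle, hJac, hJ, hJr, hJd, hJm⟩ := hSJ s hs
  obtain ⟨J', hJle', hJac', hJ', -, hJd', hJm'⟩ := hSJ' t ht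
  obtain ⟨F', hF'le, hF'ac, hF'd, hF'm⟩ := exists_join (x := x₁) (y := y₁) hacH hleH hAH hBH hAB
    (fun h => hx₁T (Or.inl h)) (fun h => hx₁T (Or.inr h)) (fun h => hy₁T (Or.inl h))
    (fun h => hy₁T (Or.inr h)) hvA hvB hxv hyv (hSA hs) (hSB ht) hst hJle hJac hJ hJr hJd hJm
    hJle' hJac' hJ' hJd' hJm'
  refine ⟨F', hF'le, hF'ac, fun z => by rw [hF'd, hdH], ?_⟩
  have m₁ := hw₁.ncard_symmDiff_le
  have m₂ := hw₂.ncard_symmDiff_le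
  have m₃ := hw₃.ncard_symmDiff_le
  have m₄ := hw₄.ncard_symmDiff_le
  have t₁ := ncard_symmDiff_trans F.edgeSet H₁.edgeSet H₂.edgeSet
  have t₂ := ncard_symmDiff_trans F.edgeSet H₂.edgeSet H₃.edgeSet
  have t₃ := ncard_symmDiff_trans F.edgeSet H₃.edgeSet H.edgeSet
  have t₄ := ncard_symmDiff_trans F.edgeSet H.edgeSet F'.edgeSet
  -- Four sequences of rotations cost `8k`, and the join costs `2(2k + 1) + 3`.
  omega

theorem mainTheorem10 :
    ∃ K : ℝ, ∀ (V : Type*) [Fintype V] (C : ℝ) (G F : SimpleGraph V) (x y : V),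
      10 ^ 10 < C →
      IsExpander C G →
      IsSpanningLinearForest G F →
      NoIsolatedVertices F →
      (1 / 10 : ℝ) * (Fintype.card V : ℝ) ≤
        (({v : V | 100 ≤ pathLength F v ∧
          (pathLength F v : ℝ) ≤ Real.sqrt (Fintype.card V : ℝ)} : Set V).ncard : ℝ) →
      x ∈ endpoints F → y ∈ endpoints F → x ≠ y →
      ∃ F' : SimpleGraph V,
        IsSpanningLinearForest G F' ∧
        NoIsolatedVertices F' ∧
        endpoints F' = endpoints F \ {x, y} ∧
        ((symmDiff F.edgeSet F'.edgeSet).ncard : ℝ) ≤ K * Real.log (Fintype.card V : ℝ) := by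
  classical
  -- The value 29 comes from `12k + 5` with `k ≤ 2 log n` and `1 ≤ log n`.
  refine ⟨29, fun V _ C G F x y hC hG hF hiso hmed hx hy hxy => ?_⟩
  set n : ℝ := (Fintype.card V : ℝ) with hn
  have hn3 : (3 : ℝ) ≤ n := by rw [hn]; exact_mod_cast hG.three_le
  have h1 : ∀ z, 1 ≤ deg F z := hiso.one_le_deg
  have h2 : ∀ z, deg F z ≤ 2 := hF.2.2
  set M : Set V := {v : V | 100 ≤ pathLength F v ∧ (pathLength F v : ℝ) ≤ √n} with hM
  have hMF : ClosedUnder F M := closedUnder_pathLength F fun l => 100 ≤ l ∧ (l : ℝ) ≤ √n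
  suffices h : ∃ F' : SimpleGraph V, F' ≤ G ∧ F'.IsAcyclic ∧
      (∀ z, deg F' z = deg F z + (if z = x then 1 else 0) + (if z = y then 1 else 0)) ∧
      ((symmDiff F.edgeSet F'.edgeSet).ncard : ℝ) ≤ 29 * Real.log n by
    obtain ⟨F', hle, hac, hd, hm⟩ := h
    obtain ⟨hlin, hiso', hend⟩ := linearForest_of_deg_eq hF hiso hx hy hxy hle hac hd
    exact ⟨F', hlin, hiso', hend, hm⟩
  rcases le_or_gt n (2 * C) with hsmall | hlarge
  -- Here singletons are large enough for the joining condition, so `G` is complete.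
  · have hμ : n / (2 * C) ≤ 1 := (div_le_one (by linarith)).2 hsmall
    have hcomplete : ∀ a b, a ≠ b → G.Adj a b := by
      intro a b hab
      obtain ⟨a', rfl, b', rfl, h⟩ := hG.joined {a} {b} (by simpa using hab)
        (by simpa using hμ) (by simpa using hμ)
      exact h
    obtain ⟨v, hv⟩ : M.Nonempty := by
      refine Set.nonempty_of_ncard_ne_zero fun h => ?_
      rw [h] at hmed
      norm_num at hmed
      linarith
    have hsqrt : 100 ≤ √n := le_trans (by exact_mod_cast hv.1) hv.2
    have hsq : √n * √n = n := Real.mul_self_sqrt (by linarith)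
    -- The paths of `x` and `y` cover at most `2(√n + 1)` vertices of `M`, fewer than `n/10` because
    -- `√n ≥ 100`.
    obtain ⟨z, hzM, hzx, hzy⟩ : ∃ z ∈ M, ¬ F.Reachable z x ∧ ¬ F.Reachable z y := by
      by_contra! h
      have hcomp : ∀ u ∈ M, ({z | F.Reachable u z}.ncard : ℝ) ≤ √n + 1 := fun u hu =>
        le_trans (by exact_mod_cast ncard_reachable_le F u) (add_le_add_left hu.2 1)
      have hav := ncard_le_ncard_avoiding (I := Set.univ) (L := {x, y}) hMF hcomp (by positivity)
      have hemp : avoiding F M {x, y} = ∅ := by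
        refine Set.eq_empty_of_forall_notMem fun u hu => ?_
        have hx' := hu.2 x (by simp)
        exact hu.2 y (by simp) (h u hu.1 fun h => hx' h.symm).symm
      rw [hemp, Set.inter_univ, Set.empty_inter, Set.ncard_empty, Set.ncard_pair hxy] at hav
      push_cast at hav
      nlinarith
    obtain ⟨w, hzw⟩ := exists_adj_of_deg_pos (h1 z)
    obtain ⟨F', hle, hac, hd, hm⟩ := exists_forest_of_complete hcomplete hF.2.1 hzw hzx hzy
    refine ⟨F', hle, hac, hd, ?_⟩
    have hlog : 1 ≤ Real.log n := by
      rw [Real.le_log_iff_exp_le (by linarith)]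
      linarith [Real.exp_one_lt_three]
    have : ((symmDiff F.edgeSet F'.edgeSet).ncard : ℝ) ≤ 3 := by exact_mod_cast hm
    linarith
  · obtain ⟨hkb, hlog, hk, hnk⟩ := rotation_count_bounds (n := n) (by linarith) rfl
    set k := ⌈Real.log n⌉₊
    have hb0 : 0 ≤ √n + 1 := by positivity
    have hb : √n + 1 ≤ n / 200 := by
      have : (0 : ℝ) ≤ k := Nat.cast_nonneg _
      nlinarith
    obtain ⟨A, B, hAM, hBM, hA, hB, hAB, hAn, hBn, hRn⟩ := exists_two_parts hMF
      (fun v hv => le_trans (by norm_num) hv.1) (fun v hv => add_le_add_left hv.2 1) h1 h2 hmed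
      hb0 hb
    have hcomp : ∀ u ∈ M, ({z | F.Reachable u z}.ncard : ℝ) ≤ √n + 1 := fun u hu =>
      le_trans (by exact_mod_cast ncard_reachable_le F u) (add_le_add_left hu.2 1)
    obtain ⟨F', hle, hac, hd, hm⟩ := exists_forest_of_expander (x := x) (y := y) hC hG hlarge
      hF.2.1 hF.1 h1 (fun v => by
        have := h2 v
        have hx' : deg F x ≤ 1 := hx
        have hy' : deg F y ≤ 1 := hy
        grind) hA hB hAB (fun v hv => hcomp v (hAM hv)) (fun v hv => hcomp v (hBM hv)) hb0 hAn hBn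
      hRn hnk hkb
    refine ⟨F', hle, hac, hd, ?_⟩
    have : ((symmDiff F.edgeSet F'.edgeSet).ncard : ℝ) ≤ 12 * k + 5 := by exact_mod_cast hm
    linarith
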